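/- Let $k$ be a commutative ring; all algebras are unital associative $k$-algebras. Let $A|B$ be an algebra extension, i.e. a unital $k$-algebra homomorphism $B\to A$ (not necessarily injective), through which $A$ is a $B$-$B$-bimodule. **Definitions.** $A|B$ is *right depth two (right D2)* if, as an $A$-$B$-bimodule, $A\otimes_B A$ is isomorphic to a direct summand of a direct sum $A^{(I)}$ of copies of $A$, for some (possibly infinite) set $I$. It is *right balanced* if, for $E=\mathrm{End}(A_B)$, the map $B\to\mathrm{End}({}_EA)$, $b\mapsto(a\mapsto ab)$, is surjective. A *right bialgebroid* $T$ over an algebra $R$ is an algebra $T$ with an algebra homomorphism $s:R\to T$ and an algebra anti-homomorphism $t:R\to T$ whose images commute, and, for the $R$-$R$-bimodule structure $r\cdot x\cdot r'=x\,t(r)\,s(r')$, with $R$-bimodule maps $\Delta:T\to T\otimes_R T$ (written $x\mapsto x_{(1)}\otimes x_{(2)}$) and $\varepsilon:T\to R$ making $T$ a coassociative counital $R$-coring, such that, for all $x,y\in T$ and $r\in R$: $s(r)x_{(1)}\otimes x_{(2)}=x_{(1)}\otimes t(r)x_{(2)}$, $\Delta(1)=1\otimes1$, $\Delta(xy)=x_{(1)}y_{(1)}\otimes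 x_{(2)}y_{(2)}$, $\varepsilon(1)=1$, and $\varepsilon(xy)=\varepsilon(s(\varepsilon(x))y)=\varepsilon(t(\varepsilon(x))y)$. It is *left projective* if $T$ is projective as a left $R$-module under $r\cdot x=x\,t(r)$. A *right $T$-comodule algebra* structure on $A$ consists of an algebra homomorphism $\eta:R\to A$ and a $k$-linear map $\delta:A\to A\otimes_R T$, $a\mapsto a_{(0)}\otimes a_{(1)}$ (where $a\cdot r=a\eta(r)$), which is right $R$-linear, i.e. $\delta(a\eta(r))=a_{(0)}\otimes a_{(1)}s(r)$, coassociative and counital ($a_{(0)}\eta(\varepsilon(a_{(1)}))=a$), and satisfies $\delta(1)=1\otimes1$, $\eta(r)a_{(0)}\otimes a_{(1)}=a_{(0)}\otimes t(r)a_{(1)}$ and $\delta(aa')=a_{(0)}a'_{(0)}\otimes a_{(1)}a'_{(1)}$. The extension $A|B$ is *right $T$-Galois* if $A$ has a right $T$-comodule algebra structure such that the image of $B$ in $A$ is the set of coinvariants $\{x\in A:\delta(x)=x\otimes1\}$ and the map $\beta:A\otimes_BA\to A\otimes_RT$, $\beta(x\otimes y)=xy_{(0)}\otimes y_{(1)}$,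 is bijective. **Theorem.** $A|B$ is right D2 and right balanced if and only if $A|B$ is right $T$-Galois for some left projective right bialgebroid $T$ over some algebra $R$. Moreover, suppose $A|B$ is right D2 and right balanced. Let $R=C_A(B)$ be the centralizer in $A$ of the image of $B$, and let $T=(A\otimes_BA)^B=\{w\in A\otimes_BA: bw=wb\ \text{for all } b\in B\}$, an algebra with multiplication $tu=u^1t^1\otimes t^2u^2$ and unit $1\otimes 1$, where $t=t^1\otimes t^2$ (summation suppressed). Then there are a set $I$ and families $\gamma_i\in\mathrm{End}({}_BA_B)$, $u_i\in T$ $(i\in I)$ such that, for each $a\in A$, $\gamma_i(a)=0$ for almost all $i$, and $x\otimes y=\sum_i x\gamma_i(y)u_i$ for all $x,y\in A$ (a *right D2 quasibase*). Moreover $T$ is a left projective right bialgebroid over $R$, and $A|B$ is right $T$-Galois, with $s(r)=1\otimes r$, $t(r)=r\otimes1$, $\varepsilon(t)=t^1t^2$, with $\eta$ the inclusion $R\subseteq A$, and with $$\Delta(t)=\sum_{i}(t^1\otimes\gamma_i(t^2))\otimes_R u_i,\qquad \delta(a)=\sum_i\gamma_i(a)\otimes_R u_i$$ for every right D2 quasibase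 $(\gamma_i,u_i)_{i\in I}$. -/

import Mathlib

open scoped TensorProduct

universe u v w x y z

noncomputable section

/-! ### Tensor products over a noncommutative ring

All modules are `k`-modules.  A right action of `R` on `M` and a left action of `R` on `N` are given
by their families of operators `α r : m ↦ m · r` and `β r : n ↦ r · n`.  The tensor product
`M ⊗_R N` is the quotient of `M ⊗[k] N` by the relations `m · r ⊗ n = m ⊗ r · n`. -/

section BalTensor

variable {k R M N P M' N' : Type*} [CommRing k]
  [AddCommGroup M] [Module k M] [AddCommGroup N] [Module k N] [AddCommGroup P] [Module k P]
  [AddCommGroup M'] [Module k M'] [AddCommGroup N'] [Module k N']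

/-- The relations `m · r ⊗ n - m ⊗ r · n`. -/
def balRel (α : R → M →ₗ[k] M) (β : R → N →ₗ[k] N) : Submodule k (M ⊗[k] N) :=
  Submodule.span k {z | ∃ (r : R) (m : M) (n : N), z = α r m ⊗ₜ[k] n - m ⊗ₜ[k] β r n}

/-- The tensor product `M ⊗_R N` of a right `R`-module and a left `R`-module. -/
abbrev BalTensor (α : R → M →ₗ[k] M) (β : R → N →ₗ[k] N) := (M ⊗[k] N) ⧸ balRel α β

namespace BalTensor

/-- The projection `M ⊗[k] N → M ⊗_R N`. -/
def mk (α : R → M →ₗ[k] M) (β : R → N →ₗ[k] N) : M ⊗[k] N →ₗ[k] BalTensor α β :=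
  (balRel α β).mkQ

/-- The pure tensor `m ⊗_R n`. -/
def tmul (α : R → M →ₗ[k] M) (β : R → N →ₗ[k] N) (m : M) (n : N) : BalTensor α β :=
  mk α β (m ⊗ₜ[k] n)

theorem mk_surjective (α : R → M →ₗ[k] M) (β : R → N →ₗ[k] N) :
    Function.Surjective (mk α β) := Submodule.mkQ_surjective _

theorem tmul_act (α : R → M →ₗ[k] M) (β : R → N →ₗ[k] N) (r : R) (m : M) (n : N) :
    tmul α β (α r m) n = tmul α β m (β r n) :=
  (Submodule.Quotient.eq _).2 (Submodule.subset_span ⟨r, m, n, rfl⟩)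

/-- The map out of `M ⊗_R N` induced by an `R`-balanced map. -/
def lift {α : R → M →ₗ[k] M} {β : R → N →ₗ[k] N} (φ : M ⊗[k] N →ₗ[k] P)
    (h : ∀ r m n, φ (α r m ⊗ₜ[k] n) = φ (m ⊗ₜ[k] β r n)) : BalTensor α β →ₗ[k] P :=
  (balRel α β).liftQ φ (Submodule.span_le.2 (by
    rintro _ ⟨r, m, n, rfl⟩
    simp [h r m n]))

@[simp] theorem lift_mk {α : R → M →ₗ[k] M} {β : R → N →ₗ[k] N} (φ : M ⊗[k] N →ₗ[k] P)
    (h : ∀ r m n, φ (α r m ⊗ₜ[k] n) = φ (m ⊗ₜ[k] β r n)) (z : M ⊗[k] N) :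
    lift φ h (mk α β z) = φ z := rfl

@[simp] theorem lift_tmul {α : R → M →ₗ[k] M} {β : R → N →ₗ[k] N} (φ : M ⊗[k] N →ₗ[k] P)
    (h : ∀ r m n, φ (α r m ⊗ₜ[k] n) = φ (m ⊗ₜ[k] β r n)) (m : M) (n : N) :
    lift φ h (tmul α β m n) = φ (m ⊗ₜ[k] n) := rfl

theorem hom_ext {α : R → M →ₗ[k] M} {β : R → N →ₗ[k] N} {φ ψ : BalTensor α β →ₗ[k] P}
    (h : ∀ m n, φ (tmul α β m n) = ψ (tmul α β m n)) : φ = ψ :=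
  Submodule.linearMap_qext _ (TensorProduct.ext' h)

/-- `f ⊗_R g` for a map `f` of right `R`-modules and a map `g` of left `R`-modules. -/
def map {α : R → M →ₗ[k] M} {β : R → N →ₗ[k] N} {α' : R → M' →ₗ[k] M'} {β' : R → N' →ₗ[k] N'}
    (f : M →ₗ[k] M') (g : N →ₗ[k] N') (hf : ∀ r m, f (α r m) = α' r (f m))
    (hg : ∀ r n, g (β r n) = β' r (g n)) : BalTensor α β →ₗ[k] BalTensor α' β' :=
  lift (mk α' β' ∘ₗ TensorProduct.map f g) (fun r m n => by
    simp only [LinearMap.comp_apply, TensorProduct.map_tmul, hf, hg]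
    exact tmul_act α' β' r (f m) (g n))

@[simp] theorem map_tmul {α : R → M →ₗ[k] M} {β : R → N →ₗ[k] N} {α' : R → M' →ₗ[k] M'}
    {β' : R → N' →ₗ[k] N'} (f : M →ₗ[k] M') (g : N →ₗ[k] N')
    (hf : ∀ r m, f (α r m) = α' r (f m)) (hg : ∀ r n, g (β r n) = β' r (g n)) (m : M) (n : N) :
    map f g hf hg (tmul α β m n) = tmul α' β' (f m) (g n) := rfl

/-- For an `R`-`R`-bimodule `N`, the right action `(m ⊗ n) · r = m ⊗ n · r` on `M ⊗_R N`. -/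
def rightAct (α : R → M →ₗ[k] M) (β γ : R → N →ₗ[k] N)
    (h : ∀ r r' n, γ r' (β r n) = β r (γ r' n)) (r : R) :
    BalTensor α β →ₗ[k] BalTensor α β :=
  map LinearMap.id (γ r) (fun _ _ => rfl) (fun r' n => h r' r n)

/-- For an `R`-`R`-bimodule `N`, the left action `r · (n ⊗ p) = r · n ⊗ p` on `N ⊗_R P`. -/
def leftAct (β γ : R → N →ₗ[k] N) (β' : R → P →ₗ[k] P)
    (h : ∀ r r' n, γ r' (β r n) = β r (γ r' n)) (r : R) :
    BalTensor γ β' →ₗ[k] BalTensor γ β' :=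
  map (β r) LinearMap.id (fun r' n => (h r r' n).symm) (fun _ _ => rfl)

@[simp] theorem rightAct_tmul (α : R → M →ₗ[k] M) (β γ : R → N →ₗ[k] N)
    (h : ∀ r r' n, γ r' (β r n) = β r (γ r' n)) (r : R) (m : M) (n : N) :
    rightAct α β γ h r (tmul α β m n) = tmul α β m (γ r n) := rfl

@[simp] theorem leftAct_tmul (β γ : R → N →ₗ[k] N) (β' : R → P →ₗ[k] P)
    (h : ∀ r r' n, γ r' (β r n) = β r (γ r' n)) (r : R) (n : N) (p : P) :
    leftAct β γ β' h r (tmul γ β' n p) = tmul γ β' (β r n) p := rfl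

/-- `m ⊗ n ↦ (p ↦ m ⊗ (n ⊗ p))`, as a map `M ⊗_R N → Hom (P, M ⊗_R (N ⊗_R P))`. -/
def assocAux (α : R → M →ₗ[k] M) (β γ : R → N →ₗ[k] N) (β' : R → P →ₗ[k] P)
    (h : ∀ r r' n, γ r' (β r n) = β r (γ r' n)) :
    BalTensor α β →ₗ[k] P →ₗ[k] BalTensor α (leftAct β γ β' h) :=
  lift (TensorProduct.curry (mk α (leftAct β γ β' h) ∘ₗ (mk γ β').lTensor M ∘ₗ
      (TensorProduct.assoc k M N P).toLinearMap)) (fun r m n => by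
    ext p
    exact tmul_act α (leftAct β γ β' h) r m (tmul γ β' n p))

/-- The associativity map `(m ⊗ n) ⊗ p ↦ m ⊗ (n ⊗ p)` from `(M ⊗_R N) ⊗_R P` to
`M ⊗_R (N ⊗_R P)`, for an `R`-`R`-bimodule `N`. -/
def assoc (α : R → M →ₗ[k] M) (β γ : R → N →ₗ[k] N) (β' : R → P →ₗ[k] P)
    (h : ∀ r r' n, γ r' (β r n) = β r (γ r' n)) :
    BalTensor (rightAct α β γ h) β' →ₗ[k] BalTensor α (leftAct β γ β' h) :=
  lift (TensorProduct.lift (assocAux α β γ β' h)) (fun r z p => by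
    have key : (assocAux α β γ β' h).flip p ∘ₗ rightAct α β γ h r
        = (assocAux α β γ β' h).flip (β' r p) := hom_ext (fun m n =>
      congrArg (tmul α (leftAct β γ β' h) m) (tmul_act γ β' r n p))
    exact LinearMap.congr_fun key z)

theorem assoc_tmul (α : R → M →ₗ[k] M) (β γ : R → N →ₗ[k] N) (β' : R → P →ₗ[k] P)
    (h : ∀ r r' n, γ r' (β r n) = β r (γ r' n)) (m : M) (n : N) (p : P) :
    assoc α β γ β' h (tmul _ _ (tmul α β m n) p) = tmul _ _ m (tmul γ β' n p) := rfl

end BalTensor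
end BalTensor

/-! ### Right bialgebroids and their comodule algebras -/

section Bialgebroid

variable {k R T A : Type*} [CommRing k] [Ring R] [Algebra k R] [Ring T] [Algebra k T]
  [Ring A] [Algebra k A]

/-- The right `R`-module structure `a · r = a η(r)` given by an algebra homomorphism `η`. -/
def homAct (η : R →ₐ[k] A) (r : R) : A →ₗ[k] A := LinearMap.mulRight k (η r)

/-- The left `R`-module structure `r · x = x t(r)` given by an algebra anti-homomorphism `t`. -/
def antiAct (t : R →ₐ[k] Tᵐᵒᵖ) (r : R) : T →ₗ[k] T := LinearMap.mulRight k (t r).unop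

theorem act_comm {s : R →ₐ[k] T} {t : R →ₐ[k] Tᵐᵒᵖ}
    (h : ∀ r r', s r * (t r').unop = (t r').unop * s r) (r r' : R) (x : T) :
    homAct s r' (antiAct t r x) = antiAct t r (homAct s r' x) := by
  simp [homAct, antiAct, mul_assoc, h]

/-- The map `a ⊗ x ↦ a η(ε(x))` from `A ⊗_R T` to `A`, for a left `R`-linear `ε : T → R`. -/
def counitRight (η : R →ₐ[k] A) (t : R →ₐ[k] Tᵐᵒᵖ) (ε : T →ₗ[k] R)
    (h : ∀ r x, ε (antiAct t r x) = r * ε x) :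
    BalTensor (homAct η) (antiAct t) →ₗ[k] A :=
  BalTensor.lift (LinearMap.mul' k A ∘ₗ TensorProduct.map LinearMap.id (η.toLinearMap ∘ₗ ε))
    (fun r a x => by simp [homAct, h, mul_assoc])

/-- The map `x ⊗ y ↦ ε(x) · y = y t(ε(x))` from `T ⊗_R T` to `T`, for a right `R`-linear
`ε : T → R`. -/
def counitLeft (s : R →ₐ[k] T) (t : R →ₐ[k] Tᵐᵒᵖ) (ε : T →ₗ[k] R)
    (h : ∀ r x, ε (homAct s r x) = ε x * r) :
    BalTensor (homAct s) (antiAct t) →ₗ[k] T :=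
  BalTensor.lift (LinearMap.mul' k T ∘ₗ TensorProduct.map LinearMap.id
      ((MulOpposite.opLinearEquiv k).symm.toLinearMap ∘ₗ t.toLinearMap ∘ₗ ε) ∘ₗ
      (TensorProduct.comm k T T).toLinearMap)
    (fun r x y => by simp [antiAct, h, mul_assoc])

/-- A right bialgebroid `T` over the algebra `R`.  The `R`-`R`-bimodule structure of `T` is
`r · x · r' = x t(r) s(r')`. -/
structure RightBialgebroid (k R T : Type*) [CommRing k] [Ring R] [Algebra k R]
    [Ring T] [Algebra k T] where
  /-- the source map, an algebra homomorphism -/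
  s : R →ₐ[k] T
  /-- the target map, an algebra anti-homomorphism -/
  t : R →ₐ[k] Tᵐᵒᵖ
  s_comm_t : ∀ r r', s r * (t r').unop = (t r').unop * s r
  /-- the comultiplication `T → T ⊗_R T` -/
  comul : T →ₗ[k] BalTensor (homAct s) (antiAct t)
  /-- the counit `T → R` -/
  counit : T →ₗ[k] R
  comul_left : ∀ r x, comul (antiAct t r x) =
    BalTensor.leftAct (antiAct t) (homAct s) (antiAct t) (act_comm s_comm_t) r (comul x)
  comul_right : ∀ r x, comul (homAct s r x) =
    BalTensor.rightAct (homAct s) (antiAct t) (homAct s) (act_comm s_comm_t) r (comul x)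
  counit_left : ∀ r x, counit (antiAct t r x) = r * counit x
  counit_right : ∀ r x, counit (homAct s r x) = counit x * r
  counit_comul : ∀ x, counitLeft s t counit counit_right (comul x) = x
  comul_counit : ∀ x, counitRight s t counit counit_left (comul x) = x
  coassoc : ∀ x,
    BalTensor.assoc (homAct s) (antiAct t) (homAct s) (antiAct t) (act_comm s_comm_t)
      (BalTensor.map
        (α' := BalTensor.rightAct (homAct s) (antiAct t) (homAct s) (act_comm s_comm_t))
        (β' := antiAct t) comul LinearMap.id comul_right (fun _ _ => rfl) (comul x)) =
    BalTensor.map (α' := homAct s)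
      (β' := BalTensor.leftAct (antiAct t) (homAct s) (antiAct t) (act_comm s_comm_t))
      LinearMap.id comul (fun _ _ => rfl) comul_left (comul x)
  /-- `s(r) x₁ ⊗ x₂ = x₁ ⊗ t(r) x₂` -/
  takeuchi : ∀ r x,
    BalTensor.map (α' := homAct s) (β' := antiAct t) (LinearMap.mulLeft k (s r)) LinearMap.id
      (fun _ _ => (mul_assoc _ _ _).symm) (fun _ _ => rfl) (comul x) =
    BalTensor.map (α' := homAct s) (β' := antiAct t) LinearMap.id
      (LinearMap.mulLeft k (t r).unop) (fun _ _ => rfl) (fun _ _ => (mul_assoc _ _ _).symm)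
      (comul x)
  comul_one : comul 1 = BalTensor.tmul _ _ 1 1
  /-- `Δ(xy) = x₁ y₁ ⊗ x₂ y₂`: the product is computed in the algebra `T ⊗[k] T` on arbitrary
  representatives of `Δ(x)` and `Δ(y)`. -/
  comul_mul : ∀ (x y : T) (X Y : T ⊗[k] T), BalTensor.mk _ _ X = comul x →
    BalTensor.mk _ _ Y = comul y → comul (x * y) = BalTensor.mk _ _ (X * Y)
  counit_one : counit 1 = 1
  counit_mul_s : ∀ x y, counit (x * y) = counit (s (counit x) * y)
  counit_mul_t : ∀ x y, counit (x * y) = counit ((t (counit x)).unop * y)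

namespace RightBialgebroid

variable (D : RightBialgebroid k R T)

/-- `T` is projective as a left `R`-module, for the action `r · x = x t(r)`. -/
def LeftProjective : Prop :=
  letI : Module R T := Module.compHom T (D.t : R →+* Tᵐᵒᵖ)
  Module.Projective R T

theorem actComm (r r' : R) (x : T) :
    homAct D.s r' (antiAct D.t r x) = antiAct D.t r (homAct D.s r' x) :=
  act_comm D.s_comm_t r r' x

/-- The structure of a right `T`-comodule algebra on `A`, for a right `R`-bialgebroid `T`.
The right `R`-module structure of `A` is `a · r = a η(r)`. -/
structure ComoduleAlgebra (D : RightBialgebroid k R T) (A : Type*) [Ring A] [Algebra k A] where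
  /-- the algebra homomorphism `R → A` -/
  η : R →ₐ[k] A
  /-- the coaction `A → A ⊗_R T` -/
  coact : A →ₗ[k] BalTensor (homAct η) (antiAct D.t)
  coact_right : ∀ r a, coact (homAct η r a) =
    BalTensor.rightAct (homAct η) (antiAct D.t) (homAct D.s) D.actComm r (coact a)
  coact_counit : ∀ a, counitRight η D.t D.counit D.counit_left (coact a) = a
  coassoc : ∀ a,
    BalTensor.assoc (homAct η) (antiAct D.t) (homAct D.s) (antiAct D.t) D.actComm
      (BalTensor.map
        (α' := BalTensor.rightAct (homAct η) (antiAct D.t) (homAct D.s) D.actComm)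
        (β' := antiAct D.t) coact LinearMap.id coact_right (fun _ _ => rfl) (coact a)) =
    BalTensor.map (α' := homAct η)
      (β' := BalTensor.leftAct (antiAct D.t) (homAct D.s) (antiAct D.t) D.actComm)
      LinearMap.id D.comul (fun _ _ => rfl) D.comul_left (coact a)
  coact_one : coact 1 = BalTensor.tmul _ _ 1 1
  /-- `r a₀ ⊗ a₁ = a₀ ⊗ t(r) a₁` -/
  takeuchi : ∀ r a,
    BalTensor.map (α' := homAct η) (β' := antiAct D.t) (LinearMap.mulLeft k (η r)) LinearMap.id
      (fun _ _ => (mul_assoc _ _ _).symm) (fun _ _ => rfl) (coact a) =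
    BalTensor.map (α' := homAct η) (β' := antiAct D.t) LinearMap.id
      (LinearMap.mulLeft k (D.t r).unop) (fun _ _ => rfl) (fun _ _ => (mul_assoc _ _ _).symm)
      (coact a)
  /-- `δ(ab) = a₀ b₀ ⊗ a₁ b₁`: the product is computed in the algebra `A ⊗[k] T` on arbitrary
  representatives of `δ(a)` and `δ(b)`. -/
  coact_mul : ∀ (a b : A) (X Y : A ⊗[k] T), BalTensor.mk _ _ X = coact a →
    BalTensor.mk _ _ Y = coact b → coact (a * b) = BalTensor.mk _ _ (X * Y)

end RightBialgebroid

end Bialgebroid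

/-! ### Algebra extensions -/

namespace AlgExt

variable {k A B : Type*} [CommRing k] [Ring A] [Algebra k A] [Ring B] [Algebra k B]
  (f : B →ₐ[k] A)

/-- The tensor-square `A ⊗_B A` of an algebra extension `f : B → A`. -/
abbrev Sq := BalTensor (fun b : B => LinearMap.mulRight k (f b))
  (fun b : B => LinearMap.mulLeft k (f b))

/-- The pure tensor `x ⊗_B y`. -/
def tmul (x y : A) : Sq f := BalTensor.tmul _ _ x y

variable {f}

theorem hom_ext {P : Type*} [AddCommGroup P] [Module k P] {φ ψ : Sq f →ₗ[k] P}
    (h : ∀ x y, φ (tmul f x y) = ψ (tmul f x y)) : φ = ψ := BalTensor.hom_ext h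

/-- The left `A`-module structure of `A ⊗_B A`. -/
def lmul (a : A) : Sq f →ₗ[k] Sq f :=
  BalTensor.map (LinearMap.mulLeft k a) LinearMap.id (fun _ _ => (mul_assoc _ _ _).symm)
    (fun _ _ => rfl)

/-- The right `A`-module structure of `A ⊗_B A`. -/
def rmul (a : A) : Sq f →ₗ[k] Sq f :=
  BalTensor.map LinearMap.id (LinearMap.mulRight k a) (fun _ _ => rfl)
    (fun _ _ => mul_assoc _ _ _)

@[simp] theorem lmul_tmul (a x y : A) : lmul a (tmul f x y) = tmul f (a * x) y := rfl
@[simp] theorem rmul_tmul (a x y : A) : rmul a (tmul f x y) = tmul f x (y * a) := rfl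

theorem tmul_add (x y y' : A) : tmul f x (y + y') = tmul f x y + tmul f x y' := by
  simp [tmul, BalTensor.tmul, TensorProduct.tmul_add]
theorem add_tmul (x x' y : A) : tmul f (x + x') y = tmul f x y + tmul f x' y := by
  simp [tmul, BalTensor.tmul, TensorProduct.add_tmul]
theorem tmul_smul (c : k) (x y : A) : tmul f x (c • y) = c • tmul f x y := by
  simp [tmul, BalTensor.tmul, TensorProduct.tmul_smul]
theorem smul_tmul (c : k) (x y : A) : tmul f (c • x) y = c • tmul f x y := by
  simp [tmul, BalTensor.tmul, ← TensorProduct.smul_tmul', map_smul]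
theorem tmul_bal (b : B) (x y : A) : tmul f (x * f b) y = tmul f x (f b * y) :=
  BalTensor.tmul_act _ _ b x y

theorem lmul_add (a a' : A) : lmul (f := f) (a + a') = lmul a + lmul a' :=
  hom_ext fun x y => by simp [add_mul, add_tmul]
theorem lmul_smul (c : k) (a : A) : lmul (f := f) (c • a) = c • lmul a :=
  hom_ext fun x y => by simp [smul_tmul]
theorem rmul_add (a a' : A) : rmul (f := f) (a + a') = rmul a + rmul a' :=
  hom_ext fun x y => by simp [mul_add, tmul_add]
theorem rmul_smul (c : k) (a : A) : rmul (f := f) (c • a) = c • rmul a :=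
  hom_ext fun x y => by simp [tmul_smul]
theorem lmul_mul (a a' : A) (z : Sq f) : lmul (a * a') z = lmul a (lmul a' z) :=
  LinearMap.congr_fun (g := lmul a ∘ₗ lmul a') (hom_ext fun x y => by simp [mul_assoc]) z
theorem rmul_mul (a a' : A) (z : Sq f) : rmul (a * a') z = rmul a' (rmul a z) :=
  LinearMap.congr_fun (g := rmul a' ∘ₗ rmul a) (hom_ext fun x y => by simp [mul_assoc]) z
theorem lmul_one (z : Sq f) : lmul 1 z = z :=
  LinearMap.congr_fun (g := LinearMap.id) (hom_ext fun x y => by simp) z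
theorem rmul_one (z : Sq f) : rmul 1 z = z :=
  LinearMap.congr_fun (g := LinearMap.id) (hom_ext fun x y => by simp) z
theorem lmul_rmul (a a' : A) (z : Sq f) : lmul a (rmul a' z) = rmul a' (lmul a z) :=
  LinearMap.congr_fun (f := lmul a ∘ₗ rmul a') (g := rmul a' ∘ₗ lmul a)
    (hom_ext fun x y => by simp) z

variable (f)

/-- The multiplication `μ : A ⊗_B A → A`. -/
def mu : Sq f →ₗ[k] A := BalTensor.lift (LinearMap.mul' k A) (fun _ _ _ => by simp [mul_assoc])

/-- The extension is right depth two: `A ⊗_B A` is isomorphic, as an `A`-`B`-bimodule, to a direct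
summand `P` (with complement `Q`) of a direct sum `A^(I)` of copies of `A`. -/
def IsRightDepthTwo {k : Type*} {A : Type u} {B : Type*} [CommRing k] [Ring A] [Algebra k A]
    [Ring B] [Algebra k B] (f : B →ₐ[k] A) : Prop :=
  ∃ (I : Type u) (P Q : Submodule k (I →₀ A)) (e : Sq f ≃ₗ[k] P),
    (∀ z ∈ P, (∀ a : A, a • z ∈ P) ∧ ∀ b : B, MulOpposite.op (f b) • z ∈ P) ∧
    (∀ z ∈ Q, (∀ a : A, a • z ∈ Q) ∧ ∀ b : B, MulOpposite.op (f b) • z ∈ Q) ∧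
    IsCompl P Q ∧
    (∀ (a : A) (z : Sq f), (e (lmul a z) : I →₀ A) = a • (e z : I →₀ A)) ∧
    ∀ (b : B) (z : Sq f), (e (rmul (f b) z) : I →₀ A) = MulOpposite.op (f b) • (e z : I →₀ A)

/-- The algebra `E = End A_B` of right `B`-linear endomorphisms of `A`. -/
def rightEnd : Subalgebra k (Module.End k A) :=
  Subalgebra.centralizer k (Set.range fun b : B => LinearMap.mulRight k (f b))

/-- `A_B` is balanced: the map `ρ : B → End _E A`, `ρ(b)(a) = a b`, is surjective, where
`E = End A_B`. -/
def IsRightBalanced : Prop :=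
  ∀ F : Module.End (rightEnd f) A, ∃ b : B, ∀ a : A, F a = a * f b

/-- The algebra `End _B A_B` of `B`-`B`-bimodule endomorphisms of `A`. -/
def bimodEnd : Subalgebra k (Module.End k A) :=
  Subalgebra.centralizer k ((Set.range fun b : B => LinearMap.mulLeft k (f b)) ∪
    Set.range fun b : B => LinearMap.mulRight k (f b))

/-- The centralizer `R = C_A(B)`. -/
abbrev Cent : Subalgebra k A := Subalgebra.centralizer k (Set.range f)

/-- The `B`-central elements `T = (A ⊗_B A)^B` of the tensor-square. -/
def TSub : Submodule k (Sq f) where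
  carrier := {z | ∀ b : B, lmul (f b) z = rmul (f b) z}
  zero_mem' b := by simp
  add_mem' {x y} hx hy b := by simp [hx b, hy b]
  smul_mem' c x hx b := by simp [hx b]

/-- The `k`-module `T = (A ⊗_B A)^B`, with the multiplication defined below. -/
def TAlg := ↥(TSub f)

instance : AddCommGroup (TAlg f) := inferInstanceAs (AddCommGroup ↥(TSub f))
instance : Module k (TAlg f) := inferInstanceAs (Module k ↥(TSub f))

namespace TAlg

variable {f}

/-- The inclusion of `(A ⊗_B A)^B` in `A ⊗_B A`. -/
def val : TAlg f →ₗ[k] Sq f := (TSub f).subtype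

theorem val_injective : Function.Injective (val (f := f)) := Subtype.val_injective

theorem lmul_val (t : TAlg f) (b : B) : lmul (f b) t.val = rmul (f b) t.val := t.2 b

/-- For `t ∈ (A ⊗_B A)^B`, the `A`-`A`-bimodule endomorphism `x ⊗ y ↦ x t y` of `A ⊗_B A`. -/
def sandwich (t : TAlg f) : Sq f →ₗ[k] Sq f :=
  BalTensor.lift (TensorProduct.lift (LinearMap.mk₂ k (fun x y => lmul x (rmul y t.val))
      (fun _ _ _ => by simp [lmul_add]) (fun _ _ _ => by simp [lmul_smul])
      (fun _ _ _ => by simp [rmul_add]) (fun _ _ _ => by simp [rmul_smul])))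
    (fun b x y => by
      simp only [TensorProduct.lift.tmul, LinearMap.mk₂_apply, LinearMap.mulRight_apply,
        LinearMap.mulLeft_apply]
      rw [lmul_mul, lmul_rmul (f b), lmul_val, rmul_mul])

@[simp] theorem sandwich_tmul (t : TAlg f) (x y : A) :
    sandwich t (tmul f x y) = lmul x (rmul y t.val) := rfl

theorem sandwich_lmul (t : TAlg f) (a : A) (z : Sq f) : sandwich t (lmul a z) = lmul a (sandwich t z) :=
  LinearMap.congr_fun (f := sandwich t ∘ₗ lmul a) (g := lmul a ∘ₗ sandwich t)
    (hom_ext fun x y => by simp [lmul_mul]) z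

theorem sandwich_rmul (t : TAlg f) (a : A) (z : Sq f) : sandwich t (rmul a z) = rmul a (sandwich t z) :=
  LinearMap.congr_fun (f := sandwich t ∘ₗ rmul a) (g := rmul a ∘ₗ sandwich t)
    (hom_ext fun x y => by simp [rmul_mul, lmul_rmul]) z

instance : One (TAlg f) :=
  ⟨⟨tmul f 1 1, fun b => by simpa using tmul_bal (f := f) b 1 1⟩⟩

/-- The multiplication `t u = u¹ t¹ ⊗ t² u²`. -/
instance : Mul (TAlg f) :=
  ⟨fun t u => ⟨sandwich t u.val, fun b => by rw [← sandwich_lmul, ← sandwich_rmul, lmul_val]⟩⟩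

theorem val_one : (1 : TAlg f).val = tmul f 1 1 := rfl
theorem val_mul (t u : TAlg f) : (t * u).val = sandwich t u.val := rfl

theorem sandwich_mul (t u : TAlg f) (z : Sq f) : sandwich (t * u) z = sandwich t (sandwich u z) :=
  LinearMap.congr_fun (f := sandwich (t * u)) (g := sandwich t ∘ₗ sandwich u)
    (hom_ext fun x y => by simp [val_mul, sandwich_lmul, sandwich_rmul]) z

theorem sandwich_add (t u : TAlg f) (z : Sq f) : sandwich (t + u) z = sandwich t z + sandwich u z :=
  LinearMap.congr_fun (f := sandwich (t + u)) (g := sandwich t + sandwich u)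
    (hom_ext fun x y => by simp) z

theorem sandwich_smul (c : k) (t : TAlg f) (z : Sq f) : sandwich (c • t) z = c • sandwich t z :=
  LinearMap.congr_fun (f := sandwich (c • t)) (g := c • sandwich t)
    (hom_ext fun x y => by simp) z

theorem sandwich_one (z : Sq f) : sandwich 1 z = z :=
  LinearMap.congr_fun (f := sandwich 1) (g := LinearMap.id)
    (hom_ext fun x y => by simp [val_one]) z

theorem sandwich_zero (z : Sq f) : sandwich 0 z = 0 :=
  LinearMap.congr_fun (f := sandwich 0) (g := 0) (hom_ext fun x y => by simp) z

instance : Ring (TAlg f) where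
  __ := (inferInstance : AddCommGroup (TAlg f))
  mul_assoc t u v := val_injective (by simp only [val_mul, sandwich_mul])
  one_mul t := val_injective (by rw [val_mul, sandwich_one])
  mul_one t := val_injective (by rw [val_mul, val_one, sandwich_tmul, rmul_one, lmul_one])
  left_distrib t u v := val_injective (by simp [val_mul])
  right_distrib t u v := val_injective (by simp [val_mul, sandwich_add])
  zero_mul t := val_injective (by simp [val_mul, sandwich_zero])
  mul_zero t := val_injective (by simp [val_mul])

instance : Algebra k (TAlg f) := Algebra.ofModule
  (fun c t u => val_injective (by simp [val_mul, sandwich_smul]))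
  (fun c t u => val_injective (by simp [val_mul]))

/-- The map `x ⊗ y ↦ x ⊗ γ(y)` on `A ⊗_B A`, for a `B`-`B`-bimodule endomorphism `γ` of `A`. -/
def mapRight (γ : bimodEnd f) : Sq f →ₗ[k] Sq f :=
  BalTensor.map LinearMap.id γ.1 (fun _ _ => rfl)
    (fun b y => (LinearMap.congr_fun (γ.2 _ (Or.inl ⟨b, rfl⟩)) y).symm)

@[simp] theorem mapRight_tmul (γ : bimodEnd f) (x y : A) :
    mapRight γ (tmul f x y) = tmul f x (γ.1 y) := rfl

theorem mapRight_lmul (γ : bimodEnd f) (a : A) (z : Sq f) :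
    mapRight γ (lmul a z) = lmul a (mapRight γ z) :=
  LinearMap.congr_fun (f := mapRight γ ∘ₗ lmul a) (g := lmul a ∘ₗ mapRight γ)
    (hom_ext fun x y => by simp) z

theorem mapRight_rmul (γ : bimodEnd f) (b : B) (z : Sq f) :
    mapRight γ (rmul (f b) z) = rmul (f b) (mapRight γ z) :=
  LinearMap.congr_fun (f := mapRight γ ∘ₗ rmul (f b)) (g := rmul (f b) ∘ₗ mapRight γ)
    (hom_ext fun x y => by
      have h : γ.1 (y * f b) = γ.1 y * f b :=
        (LinearMap.congr_fun (γ.2 _ (Or.inr ⟨b, rfl⟩)) y).symm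
      simp [h]) z

/-- The map `t ↦ t¹ ⊗ γ(t²)` on `(A ⊗_B A)^B`, for a `B`-`B`-bimodule endomorphism `γ` of `A`. -/
def applyRight (γ : bimodEnd f) (t : TAlg f) : TAlg f :=
  ⟨mapRight γ t.val, fun b => by
    rw [← mapRight_lmul, lmul_val, mapRight_rmul]⟩

end TAlg

/-- `(γ i, u i)` is a right depth two quasibase: for each `a`, `γ i a = 0` for almost all `i`, and
`x ⊗ y = ∑ x γ i (y) u i`. -/
def IsRightQuasibase {I : Type*} (γ : I → bimodEnd f) (u : I → TAlg f) : Prop :=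
  (∀ a : A, {i | (γ i).1 a ≠ 0}.Finite) ∧
  ∀ x y : A, tmul f x y = ∑ᶠ i, lmul (x * (γ i).1 y) (u i).val

end AlgExt

/-! ### Galois extensions -/

namespace RightBialgebroid.ComoduleAlgebra

variable {k R T A B : Type*} [CommRing k] [Ring R] [Algebra k R] [Ring T] [Algebra k T]
  [Ring A] [Algebra k A] [Ring B] [Algebra k B]
  {D : RightBialgebroid k R T}
  (C : ComoduleAlgebra D A)

/-- `A ⊗_R T`. -/
abbrev Tens := BalTensor (homAct C.η) (antiAct D.t)

/-- The left multiplication `a (a' ⊗ x) = a a' ⊗ x` on `A ⊗_R T`. -/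
def lmul (a : A) : C.Tens →ₗ[k] C.Tens :=
  BalTensor.map (LinearMap.mulLeft k a) LinearMap.id (fun _ _ => (mul_assoc _ _ _).symm)
    (fun _ _ => rfl)

theorem hom_ext {P : Type*} [AddCommGroup P] [Module k P] {φ ψ : C.Tens →ₗ[k] P}
    (h : ∀ a x, φ (BalTensor.tmul _ _ a x) = ψ (BalTensor.tmul _ _ a x)) : φ = ψ :=
  BalTensor.hom_ext h

@[simp] theorem lmul_tmul (a a' : A) (x : T) :
    C.lmul a (BalTensor.tmul _ _ a' x) = BalTensor.tmul _ _ (a * a') x := rfl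

theorem lmul_add (a a' : A) : C.lmul (a + a') = C.lmul a + C.lmul a' :=
  C.hom_ext fun x y => by
    rw [LinearMap.add_apply, lmul_tmul, lmul_tmul, lmul_tmul, add_mul]
    simp [BalTensor.tmul, TensorProduct.add_tmul]

theorem lmul_smul (c : k) (a : A) : C.lmul (c • a) = c • C.lmul a :=
  C.hom_ext fun x y => by
    rw [LinearMap.smul_apply, lmul_tmul, lmul_tmul, smul_mul_assoc]
    simp [BalTensor.tmul, ← TensorProduct.smul_tmul', map_smul]

theorem lmul_mul (a a' : A) (z : C.Tens) : C.lmul (a * a') z = C.lmul a (C.lmul a' z) :=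
  LinearMap.congr_fun (g := C.lmul a ∘ₗ C.lmul a') (C.hom_ext fun x y => by simp [mul_assoc]) z

/-- The coinvariants `{x | δ(x) = x ⊗ 1}`. -/
def coinvariants : Set A := {x | C.coact x = BalTensor.tmul _ _ x 1}

theorem coact_coinvariant_mul {b : A} (hb : b ∈ C.coinvariants) (y : A) :
    C.coact (b * y) = C.lmul b (C.coact y) := by
  obtain ⟨Y, hY⟩ := BalTensor.mk_surjective _ _ (C.coact y)
  rw [C.coact_mul b y (b ⊗ₜ 1) Y hb.symm hY, ← hY]
  have : BalTensor.mk (homAct C.η) (antiAct D.t) ∘ₗ LinearMap.mulLeft k (b ⊗ₜ[k] (1 : T)) =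
      C.lmul b ∘ₗ BalTensor.mk (homAct C.η) (antiAct D.t) :=
    TensorProduct.ext' fun a x => by
      simp only [LinearMap.comp_apply, LinearMap.mulLeft_apply,
        Algebra.TensorProduct.tmul_mul_tmul, one_mul]
      rfl
  exact LinearMap.congr_fun this Y

/-- The canonical map `β : A ⊗_B A → A ⊗_R T`, `β(x ⊗ y) = x y₀ ⊗ y₁`, for an algebra extension
`f : B → A` with image in the coinvariants. -/
def canonicalMap (f : B →ₐ[k] A) (hf : ∀ b, f b ∈ C.coinvariants) :
    AlgExt.Sq f →ₗ[k] C.Tens :=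
  BalTensor.lift (TensorProduct.lift (LinearMap.mk₂ k (fun x y => C.lmul x (C.coact y))
      (fun _ _ _ => by simp [lmul_add]) (fun _ _ _ => by simp [lmul_smul])
      (fun _ _ _ => by simp) (fun _ _ _ => by simp)))
    (fun b x y => by
      simp only [TensorProduct.lift.tmul, LinearMap.mk₂_apply, LinearMap.mulRight_apply,
        LinearMap.mulLeft_apply, lmul_mul, C.coact_coinvariant_mul (hf b)])

/-- `A | B` is right `T`-Galois with respect to the given comodule algebra structure: the
coinvariants are the image of `B` and the canonical map is bijective. -/
structure IsGalois (f : B →ₐ[k] A) : Prop where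
  range_eq : Set.range f = C.coinvariants
  bijective : Function.Bijective
    (C.canonicalMap f fun b => range_eq ▸ Set.mem_range_self b)

end RightBialgebroid.ComoduleAlgebra

/-- The algebra extension `f : B → A` is right `T`-Galois for the right bialgebroid `T`. -/
def RightBialgebroid.IsGaloisExtension {k R T A B : Type*} [CommRing k] [Ring R] [Algebra k R]
    [Ring T] [Algebra k T] [Ring A] [Algebra k A] [Ring B] [Algebra k B]
    (D : RightBialgebroid k R T) (f : B →ₐ[k] A) : Prop :=
  ∃ C : D.ComoduleAlgebra A, C.IsGalois f

end

/-!
# Galois extensions for bialgebroids and extensions of depth two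

Write `R = C_A(B)` and `T = (A ⊗_B A)^B`. An endomorphism `ψ` of the `B`-`B`-bimodule `A` yields the
functional `x ⊗ y ↦ x ψ(y)` on `A ⊗_B A`, called `coeff ψ` below, which restricts to a left
`R`-linear functional `T → R`. A right D2 quasibase `(γ_i, e_i)` says that the functionals of the
`γ_i` together with the elements `e_i` are a dual basis of the left `A`-module `A ⊗_B A` and of the
left `R`-module `T`. It is read off from a splitting of `A ⊗_B A` in `A^(I)`
(`IsRightDepthTwo.exists_quasibase`).

For any algebra `M` over `R`, an element of `M ⊗_R T` is therefore determined by its coordinates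
under the maps `coord ψ : m ⊗ t ↦ m (t¹ ψ(t²))` (`IsRightQuasibase.coord_ext`), and an element of
`M ⊗_R (T ⊗_R T)` by its images in `M ⊗_R T` (`IsRightQuasibase.coord₂_ext`). Let the algebra
`End _B A_B` act on `M = A` tautologically and on `M = T` through the second tensor factor. The
coaction `δ(m) = ∑ γ_i(m) ⊗ e_i`, which is the coaction of the theorem for `M = A` and the
comultiplication for `M = T`, has the coordinates `coord ψ (δ m) = ψ(m)`. These do not involve the
quasibase, so neither does `δ`, and each axiom of a bialgebroid or comodule algebra becomes an
identity between actions: coassociativity is `(χψ)(m) = χ(ψ(m))`, counitality is `1(m) = m`, and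
multiplicativity is the expansion in `EndoAction.Adapted`. Both cases are treated at once by the
structure `EndoAction`.

The inverse of the canonical map `A ⊗_B A → A ⊗_R T` is `a ⊗ t ↦ a t`. It sends `δ(x)` to `1 ⊗ x`,
so `x` is coinvariant if and only if `1 ⊗ x = x ⊗ 1`; then right multiplication by `x` is
`End A_B`-linear, and balancedness gives `x ∈ B` (`IsRightQuasibase.isGalois`).

Conversely, let `A | B` be `T`-Galois with `T` left projective. Coinvariants commute with `η(R)`, so
a dual basis `(φ_j, e_j)` of the left `R`-module `T` gives `A`-`B`-bimodule functionals
`a ⊗ x ↦ a η(φ_j(x))` on `A ⊗_R T`, dual to the `B`-central elements `1 ⊗ e_j`. Through the canonical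
isomorphism this proves depth two. The same functionals, composed with the coaction, lie in
`End A_B`, which forces `F 1` to be coinvariant for each `End A_B`-linear `F : A → A`
(`RightBialgebroid.DualBasis.isRightBalanced`).
-/

noncomputable section

/-! ### Locally finite sums -/

section HasFinsum

variable {I k N N' : Type*} [CommRing k] [AddCommGroup N] [Module k N] [AddCommGroup N']
  [Module k N']

/-- Almost all terms of the family `g` vanish, and their sum is `x`.  This is encoded as eventual
constancy of the finite partial sums, that is, as `HasSum` for the discrete topology. -/
def HasFinsum (g : I → N) (x : N) : Prop :=
  ∀ᶠ S in (Filter.atTop : Filter (Finset I)), ∑ i ∈ S, g i = x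

namespace HasFinsum

variable {g g' : I → N} {x x' : N}

theorem unique (h : HasFinsum g x) (h' : HasFinsum g x') : x = x' := by
  obtain ⟨S, hS, hS'⟩ := (h.and h').exists
  exact hS.symm.trans hS'

theorem add (h : HasFinsum g x) (h' : HasFinsum g' x') :
    HasFinsum (fun i => g i + g' i) (x + x') := by
  filter_upwards [h, h'] with S hS hS'
  rw [Finset.sum_add_distrib, hS, hS']

theorem map (h : HasFinsum g x) (L : N →ₗ[k] N') : HasFinsum (fun i => L (g i)) (L x) := by
  filter_upwards [h] with S hS
  rw [← map_sum, hS]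

theorem of_map_injective {L : N →ₗ[k] N'} (hL : Function.Injective L)
    (h : HasFinsum (fun i => L (g i)) (L x)) : HasFinsum g x := by
  filter_upwards [h] with S hS
  rw [← map_sum] at hS
  exact hL hS

theorem congr (h : HasFinsum g x) (hg : ∀ i, g i = g' i) (hx : x = x') : HasFinsum g' x' := by
  obtain rfl : g = g' := funext hg
  exact hx ▸ h

theorem support_finite (h : HasFinsum g x) : (Function.support g).Finite := by
  classical
  obtain ⟨S, hS⟩ := Filter.eventually_atTop.1 h
  refine S.finite_toSet.subset fun i hi => ?_
  by_contra hiS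
  have h1 := hS (insert i S) (Finset.subset_insert i S)
  rw [Finset.sum_insert (by simpa using hiS), hS S le_rfl] at h1
  exact hi (by simpa using h1)

theorem of_finite (h : (Function.support g).Finite) : HasFinsum g (∑ᶠ i, g i) :=
  Filter.eventually_atTop.2 ⟨h.toFinset, fun _ hS =>
    (finsum_eq_sum_of_support_subset g fun _ hi => hS (h.mem_toFinset.2 hi)).symm⟩

theorem finsum_eq (h : HasFinsum g x) : ∑ᶠ i, g i = x :=
  (of_finite h.support_finite).unique h

theorem of_finsupp {A : Type*} [Zero A] (z : I →₀ A) {L : I → A → N} (hL : ∀ i, L i 0 = 0) :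
    HasFinsum (fun i => L i (z i)) (z.sum L) :=
  Filter.eventually_atTop.2 ⟨z.support, fun _ hS =>
    (Finsupp.sum_of_support_subset _ hS _ fun i _ => hL i).symm⟩

theorem comp_injective {J : Type*} {ι : J → I} (h : HasFinsum g x) (hι : Function.Injective ι)
    (hs : Function.support g ⊆ Set.range ι) : HasFinsum (fun j => g (ι j)) x := by
  classical
  obtain ⟨S, hS⟩ := Filter.eventually_atTop.1 h
  refine Filter.eventually_atTop.2 ⟨S.preimage ι hι.injOn, fun S' hS' => ?_⟩
  rw [← hS (S ∪ S'.map ⟨ι, hι⟩) Finset.subset_union_left,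
    ← Finset.sum_subset (Finset.subset_union_right (s₁ := S)), Finset.sum_map]
  · rfl
  · intro i hi hi'
    by_contra hg
    obtain ⟨j, rfl⟩ := hs hg
    have hj : j ∉ S' := fun hj => hi' (Finset.mem_map_of_mem ⟨ι, hι⟩ hj)
    rcases Finset.mem_union.1 hi with hi | hi
    · exact hj (hS' (Finset.mem_preimage.2 hi))
    · exact hi' hi

end HasFinsum

end HasFinsum

namespace BalTensor

variable {k R M N P I : Type*} [CommRing k]
  [AddCommGroup M] [Module k M] [AddCommGroup N] [Module k N] [AddCommGroup P] [Module k P]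
  {α : R → M →ₗ[k] M} {β : R → N →ₗ[k] N}

/-- A linear map on `M ⊗_R N` is the locally finite sum of a family of linear maps if this holds on
pure tensors. -/
theorem hasFinsum_of_tmul {L : I → BalTensor α β →ₗ[k] P} {L' : BalTensor α β →ₗ[k] P}
    (h : ∀ m n, HasFinsum (fun i => L i (tmul α β m n)) (L' (tmul α β m n)))
    (z : BalTensor α β) : HasFinsum (fun i => L i z) (L' z) := by
  obtain ⟨z, rfl⟩ := mk_surjective α β z
  induction z with
  | zero => exact (h 0 0).congr (fun i => by simp [tmul]) (by simp [tmul])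
  | tmul m n => exact h m n
  | add z z' hz hz' => exact (hz.add hz').congr (fun i => by simp) (by simp)

theorem finite_of_tmul {L : I → BalTensor α β →ₗ[k] P}
    (h : ∀ m n, {i | L i (tmul α β m n) ≠ 0}.Finite)
    (z : BalTensor α β) : {i | L i z ≠ 0}.Finite := by
  obtain ⟨z, rfl⟩ := mk_surjective α β z
  induction z with
  | zero => simp
  | tmul m n => exact h m n
  | add z z' hz hz' =>
    refine (hz.union hz').subset fun i hi => ?_
    by_contra hc
    simp only [Set.mem_union, Set.mem_ofPred_eq, not_or, not_not] at hc
    exact hi (by rw [map_add, map_add, hc.1, hc.2, add_zero])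

variable (α β)

/-- `m ↦ m ⊗ n` -/
def tmulLeft (n : N) : M →ₗ[k] BalTensor α β := mk α β ∘ₗ (TensorProduct.mk k M N).flip n

/-- `n ↦ m ⊗ n` -/
def tmulRight (m : M) : N →ₗ[k] BalTensor α β := mk α β ∘ₗ TensorProduct.mk k M N m

end BalTensor

namespace AlgExt

variable {k A B : Type*} [CommRing k] [Ring A] [Algebra k A] [Ring B] [Algebra k B]
  {f : B →ₐ[k] A}

theorem mu_tmul (x y : A) : mu f (tmul f x y) = x * y := rfl

theorem mu_lmul (a : A) (z : Sq f) : mu f (lmul a z) = a * mu f z :=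
  LinearMap.congr_fun (f := mu f ∘ₗ lmul a) (g := LinearMap.mulLeft k a ∘ₗ mu f)
    (hom_ext fun x y => by simp [mu_tmul, mul_assoc]) z

theorem mu_rmul (a : A) (z : Sq f) : mu f (rmul a z) = mu f z * a :=
  LinearMap.congr_fun (f := mu f ∘ₗ rmul a) (g := LinearMap.mulRight k a ∘ₗ mu f)
    (hom_ext fun x y => by simp [mu_tmul, mul_assoc]) z

/-- `a ↦ a z` -/
def lmulAt (z : Sq f) : A →ₗ[k] Sq f where
  toFun a := lmul a z
  map_add' a a' := by simp [lmul_add]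
  map_smul' c a := by simp [lmul_smul]

/-- `a ↦ z a` -/
def rmulAt (z : Sq f) : A →ₗ[k] Sq f where
  toFun a := rmul a z
  map_add' a a' := by simp [rmul_add]
  map_smul' c a := by simp [rmul_smul]

@[simp] theorem lmulAt_apply (z : Sq f) (a : A) : lmulAt z a = lmul a z := rfl
@[simp] theorem rmulAt_apply (z : Sq f) (a : A) : rmulAt z a = rmul a z := rfl

theorem mem_bimodEnd {g : Module.End k A} (hl : ∀ b y, g (f b * y) = f b * g y)
    (hr : ∀ b y, g (y * f b) = g y * f b) : g ∈ bimodEnd f := by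
  rintro _ (⟨b, rfl⟩ | ⟨b, rfl⟩)
  · exact LinearMap.ext fun y => (hl b y).symm
  · exact LinearMap.ext fun y => (hr b y).symm

theorem cent_comm (r : Cent f) (b : B) : f b * r = r * f b := r.2 _ ⟨b, rfl⟩

theorem mem_cent {a : A} (h : ∀ b, f b * a = a * f b) : a ∈ Cent f := by
  rintro _ ⟨b, rfl⟩
  exact h b

open TAlg

/-! ### The endomorphisms of `A` as functionals on `A ⊗_B A` -/

/-- The map `x ⊗ y ↦ x ψ(y)` from `A ⊗_B A` to `A`. -/
def coeff (ψ : bimodEnd f) : Sq f →ₗ[k] A := mu f ∘ₗ mapRight ψ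

@[simp] theorem coeff_tmul (ψ : bimodEnd f) (x y : A) : coeff ψ (tmul f x y) = x * ψ.1 y := rfl

theorem coeff_lmul (ψ : bimodEnd f) (a : A) (z : Sq f) : coeff ψ (lmul a z) = a * coeff ψ z := by
  simp [coeff, mapRight_lmul, mu_lmul]

theorem coeff_rmul (ψ : bimodEnd f) (b : B) (z : Sq f) :
    coeff ψ (rmul (f b) z) = coeff ψ z * f b := by
  simp [coeff, mapRight_rmul, mu_rmul]

theorem coeff_val_mem (ψ : bimodEnd f) (t : TAlg f) : coeff ψ t.val ∈ Cent f :=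
  mem_cent fun b => by rw [← coeff_lmul, ← coeff_rmul, lmul_val]

/-- The map `t ↦ t¹ ψ(t²)` from `T` to `R`. -/
def coeffT (ψ : bimodEnd f) : TAlg f →ₗ[k] Cent f :=
  LinearMap.codRestrict (Subalgebra.toSubmodule (Cent f)) (coeff ψ ∘ₗ val) (coeff_val_mem ψ)

@[simp] theorem coe_coeffT (ψ : bimodEnd f) (t : TAlg f) : (coeffT ψ t : A) = coeff ψ t.val := rfl

/-- Left multiplication by `r ∈ R` as an endomorphism of the `B`-`B`-bimodule `A`. -/
def leftMul (r : Cent f) : bimodEnd f :=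
  ⟨LinearMap.mulLeft k (r : A), mem_bimodEnd
    (fun b y => by simp only [LinearMap.mulLeft_apply, ← mul_assoc, cent_comm])
    (fun b y => by simp [mul_assoc])⟩

/-- Right multiplication by `r ∈ R` as an endomorphism of the `B`-`B`-bimodule `A`. -/
def rightMul (r : Cent f) : bimodEnd f :=
  ⟨LinearMap.mulRight k (r : A), mem_bimodEnd
    (fun b y => by simp [mul_assoc])
    (fun b y => by simp only [LinearMap.mulRight_apply, mul_assoc, cent_comm])⟩

theorem leftMul_apply (r : Cent f) (a : A) : (leftMul r).1 a = r * a := rfl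
theorem rightMul_apply (r : Cent f) (a : A) : (rightMul r).1 a = a * r := rfl
theorem mul_coe_apply (ψ χ : bimodEnd f) (a : A) : (ψ * χ).1 a = ψ.1 (χ.1 a) := rfl

theorem coeff_mul (ψ χ : bimodEnd f) (z : Sq f) : coeff (ψ * χ) z = coeff ψ (mapRight χ z) :=
  LinearMap.congr_fun (f := coeff (ψ * χ)) (g := coeff ψ ∘ₗ mapRight χ)
    (hom_ext fun x y => by simp) z

theorem coeff_one (z : Sq f) : coeff 1 z = mu f z :=
  LinearMap.congr_fun (f := coeff 1) (g := mu f) (hom_ext fun x y => by simp [mu_tmul]) z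

theorem coeff_mul_rightMul (ψ : bimodEnd f) (r : Cent f) (z : Sq f) :
    coeff (ψ * rightMul r) z = coeff ψ (rmul (r : A) z) :=
  LinearMap.congr_fun (f := coeff (ψ * rightMul r)) (g := coeff ψ ∘ₗ rmul (r : A))
    (hom_ext fun x y => by simp [rightMul_apply]) z

/-- For `v ∈ T`, the endomorphism `y ↦ v¹ ψ(v² y)` of the `B`-`B`-bimodule `A`. -/
def twist (ψ : bimodEnd f) : TAlg f →ₗ[k] bimodEnd f where
  toFun v := ⟨coeff ψ ∘ₗ rmulAt v.val, mem_bimodEnd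
    (fun b y => by simp [rmul_mul, ← lmul_val, ← lmul_rmul, coeff_lmul])
    (fun b y => by simp [rmul_mul, coeff_rmul])⟩
  map_add' v v' := Subtype.ext (LinearMap.ext fun y => by simp)
  map_smul' c v := Subtype.ext (LinearMap.ext fun y => by simp)

@[simp] theorem twist_apply (ψ : bimodEnd f) (v : TAlg f) (y : A) :
    (twist ψ v).1 y = coeff ψ (rmul y v.val) := rfl

theorem coeff_twist (ψ : bimodEnd f) (v : TAlg f) (z : Sq f) :
    coeff (twist ψ v) z = coeff ψ (sandwich v z) :=
  LinearMap.congr_fun (f := coeff (twist ψ v)) (g := coeff ψ ∘ₗ sandwich v)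
    (hom_ext fun x y => by simp [coeff_lmul]) z

theorem coeffT_twist (ψ : bimodEnd f) (v u : TAlg f) :
    coeffT (twist ψ v) u = coeffT ψ (v * u) :=
  Subtype.ext (coeff_twist ψ v u.val)

/-! ### Source and target maps of `(A ⊗_B A)^B` -/

variable (f)

/-- The source map `r ↦ 1 ⊗ r`. -/
def source : Cent f →ₐ[k] TAlg f :=
  AlgHom.ofLinearMap
    (LinearMap.codRestrict (TSub f)
      (rmulAt (tmul f 1 1) ∘ₗ (Cent f).val.toLinearMap) (fun r b => by
        have := tmul_bal (f := f) b 1 (r : A)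
        simpa [cent_comm] using this))
    (val_injective (by change rmul ((1 : Cent f) : A) (tmul f 1 1) = _; simp [val_one]))
    (fun r r' => val_injective (by
      rw [val_mul]
      change rmul ((r : A) * (r' : A)) (tmul f 1 1) = sandwich _ (rmul (r' : A) (tmul f 1 1))
      rw [sandwich_rmul, rmul_mul]
      congr 1
      simp only [sandwich_tmul, lmul_one, rmul_one]
      rfl))

/-- The target map `r ↦ r ⊗ 1`. -/
def target : Cent f →ₐ[k] (TAlg f)ᵐᵒᵖ :=
  AlgHom.ofLinearMap
    ((MulOpposite.opLinearEquiv k).toLinearMap ∘ₗ LinearMap.codRestrict (TSub f)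
      (lmulAt (tmul f 1 1) ∘ₗ (Cent f).val.toLinearMap) (fun r b => by
        have := tmul_bal (f := f) b (r : A) 1
        simpa [cent_comm] using this))
    (MulOpposite.unop_injective (val_injective (by change lmul ((1 : Cent f) : A) (tmul f 1 1) = _; simp [val_one])))
    (fun r r' => MulOpposite.unop_injective (val_injective (by
      rw [MulOpposite.unop_mul, val_mul]
      change lmul ((r : A) * (r' : A)) (tmul f 1 1) = sandwich _ (lmul (r : A) (tmul f 1 1))
      rw [sandwich_lmul, lmul_mul]
      congr 1
      simp only [sandwich_tmul, lmul_one, rmul_one]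
      rfl)))

variable {f}

theorem source_val (r : Cent f) : (source f r).val = tmul f 1 (r : A) := by
  change rmul (r : A) (tmul f 1 1) = _; simp

theorem target_val (r : Cent f) : (target f r).unop.val = tmul f (r : A) 1 := by
  change lmul (r : A) (tmul f 1 1) = _; simp

theorem source_comm_target (r r' : Cent f) :
    source f r * (target f r').unop = (target f r').unop * source f r :=
  val_injective (by simp [val_mul, source_val, target_val])

theorem antiAct_val (r : Cent f) (t : TAlg f) :
    (antiAct (target f) r t).val = lmul (r : A) t.val := by
  simp [antiAct, val_mul, target_val, rmul_one]

theorem homAct_val (r : Cent f) (t : TAlg f) :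
    (homAct (source f) r t).val = rmul (r : A) t.val := by
  simp [homAct, val_mul, source_val, lmul_one]

theorem mul_source_val (t : TAlg f) (r : Cent f) : (t * source f r).val = rmul (r : A) t.val :=
  homAct_val r t

theorem source_mul_val (t : TAlg f) (r : Cent f) :
    (source f r * t).val = mapRight (leftMul r) t.val := by
  rw [val_mul]
  exact LinearMap.congr_fun (hom_ext fun x y => by simp [source_val, leftMul_apply]) t.val

theorem coeffT_antiAct (ψ : bimodEnd f) (r : Cent f) (t : TAlg f) :
    coeffT ψ (antiAct (target f) r t) = r * coeffT ψ t :=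
  Subtype.ext (by rw [coe_coeffT, antiAct_val, coeff_lmul]; rfl)

theorem coeffT_homAct (ψ : bimodEnd f) (r : Cent f) (t : TAlg f) :
    coeffT ψ (homAct (source f) r t) = coeffT (ψ * rightMul r) t :=
  Subtype.ext (by rw [coe_coeffT, coe_coeffT, homAct_val, coeff_mul_rightMul])

theorem coeffT_target_mul (ψ : bimodEnd f) (r : Cent f) (t : TAlg f) :
    coeffT ψ ((target f r).unop * t) = coeffT (leftMul r * ψ) t :=
  Subtype.ext (by
    rw [coe_coeffT, coe_coeffT, val_mul]
    exact LinearMap.congr_fun (f := coeff ψ ∘ₗ sandwich _) (g := coeff (leftMul r * ψ))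
      (hom_ext fun x y => by
        simp [target_val, leftMul_apply, mul_assoc]) t.val)

theorem twist_antiAct (ψ : bimodEnd f) (r : Cent f) (v : TAlg f) :
    twist ψ (antiAct (target f) r v) = leftMul r * twist ψ v :=
  Subtype.ext (LinearMap.ext fun y => by
    rw [mul_coe_apply, leftMul_apply, twist_apply, twist_apply, antiAct_val, ← lmul_rmul,
      coeff_lmul])

/-! ### Quasibases -/

section Quasibase

variable {I : Type*} {γ : I → bimodEnd f} {e : I → TAlg f}

theorem IsRightQuasibase.hasFinsum_tmul (h : IsRightQuasibase f γ e) (x y : A) :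
    HasFinsum (fun i => lmul (x * (γ i).1 y) (e i).val) (tmul f x y) := by
  have hfin : (Function.support fun i => lmul (x * (γ i).1 y) (e i).val).Finite :=
    (h.1 y).subset fun i hi hc => hi (by
      change lmulAt (e i).val (x * (γ i).1 y) = 0
      rw [hc, mul_zero, map_zero])
  have := HasFinsum.of_finite hfin
  rwa [← h.2 x y] at this

/-- The elements `e i` and the functionals `x ⊗ y ↦ x γ_i(y)` form a dual basis of `A ⊗_B A`. -/
theorem IsRightQuasibase.hasFinsum (h : IsRightQuasibase f γ e) (z : Sq f) :
    HasFinsum (fun i => lmul (coeff (γ i) z) (e i).val) z :=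
  BalTensor.hasFinsum_of_tmul (L := fun i => lmulAt (e i).val ∘ₗ coeff (γ i))
    (L' := LinearMap.id) h.hasFinsum_tmul z

/-- The elements `e i` and the functionals `t ↦ t¹ γ_i(t²)` form a dual basis of the left
`R`-module `T`. -/
theorem IsRightQuasibase.hasFinsum_TAlg (h : IsRightQuasibase f γ e) (t : TAlg f) :
    HasFinsum (fun i => antiAct (target f) (coeffT (γ i) t) (e i)) t :=
  .of_map_injective val_injective
    ((h.hasFinsum t.val).congr (fun i => by rw [antiAct_val, coe_coeffT]) rfl)

theorem IsRightQuasibase.applyRight_finite (h : IsRightQuasibase f γ e) (t : TAlg f) :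
    {i | applyRight (γ i) t ≠ 0}.Finite :=
  (BalTensor.finite_of_tmul (L := fun i => mapRight (γ i)) (fun x y => (h.1 y).subset
    fun i hi hc => hi (by
      change tmul f x ((γ i).1 y) = 0
      rw [hc]
      exact (BalTensor.tmulRight _ _ x).map_zero)) t.val).subset
    fun i hi hc => hi (val_injective (hc.trans (map_zero val).symm))

end Quasibase

/-! ### Coordinates on `M ⊗_R T` -/

section Coord

variable {M : Type*} [Ring M] [Algebra k M] (η : Cent f →ₐ[k] M)

/-- The map `m ⊗ t ↦ m η(t¹ ψ(t²))` from `M ⊗_R T` to `M`. -/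
def coord (ψ : bimodEnd f) : BalTensor (homAct η) (antiAct (target f)) →ₗ[k] M :=
  counitRight η (target f) (coeffT ψ) (coeffT_antiAct ψ)

@[simp] theorem coord_tmul (ψ : bimodEnd f) (m : M) (t : TAlg f) :
    coord η ψ (BalTensor.tmul _ _ m t) = m * η (coeffT ψ t) := rfl

variable {I : Type*} {γ : I → bimodEnd f} {e : I → TAlg f}

theorem IsRightQuasibase.hasFinsum_coord (h : IsRightQuasibase f γ e)
    (Z : BalTensor (homAct η) (antiAct (target f))) :
    HasFinsum (fun i => BalTensor.tmul (homAct η) (antiAct (target f)) (coord η (γ i) Z) (e i)) Z :=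
  BalTensor.hasFinsum_of_tmul
    (L := fun i => BalTensor.tmulLeft (homAct η) (antiAct (target f)) (e i) ∘ₗ coord η (γ i))
    (L' := LinearMap.id)
    (fun m t => ((h.hasFinsum_TAlg t).map
      (BalTensor.tmulRight (homAct η) (antiAct (target f)) m)).congr
        (fun i => (BalTensor.tmul_act (homAct η) (antiAct (target f)) _ m (e i)).symm) rfl) Z

/-- The coordinates separate the elements of `M ⊗_R T`. -/
theorem IsRightQuasibase.coord_ext (h : IsRightQuasibase f γ e)
    {Z Z' : BalTensor (homAct η) (antiAct (target f))}
    (hZ : ∀ ψ, coord η ψ Z = coord η ψ Z') : Z = Z' :=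
  (h.hasFinsum_coord η Z).unique
    ((h.hasFinsum_coord η Z').congr (fun i => by rw [hZ]) rfl)

/-- The left action of `R` on `T ⊗_R T`. -/
abbrev leftActTT (r : Cent f) := BalTensor.leftAct (antiAct (target f)) (homAct (source f))
  (antiAct (target f)) (act_comm source_comm_target) r

theorem coord_source_leftAct (ψ : bimodEnd f) (r : Cent f)
    (Z : BalTensor (homAct (source f)) (antiAct (target f))) :
    coord (source f) ψ (leftActTT r Z) = antiAct (target f) r (coord (source f) ψ Z) :=
  LinearMap.congr_fun (f := coord (source f) ψ ∘ₗ leftActTT r)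
    (g := antiAct (target f) r ∘ₗ coord (source f) ψ)
    (BalTensor.hom_ext fun t u => by
      simp only [LinearMap.comp_apply, BalTensor.leftAct_tmul, coord_tmul]
      exact act_comm source_comm_target r _ t) Z

/-- The map `m ⊗ (t ⊗ u) ↦ m ⊗ t s(u¹ ψ(u²))` from `M ⊗_R (T ⊗_R T)` to `M ⊗_R T`. -/
def coord₂ (ψ : bimodEnd f) : BalTensor (homAct η) (leftActTT (f := f)) →ₗ[k]
    BalTensor (homAct η) (antiAct (target f)) :=
  BalTensor.map LinearMap.id (coord (source f) ψ) (fun _ _ => rfl) (coord_source_leftAct ψ)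

/-- The maps `coord₂ ψ` separate the elements of `M ⊗_R (T ⊗_R T)`. -/
theorem IsRightQuasibase.coord₂_ext (h : IsRightQuasibase f γ e)
    {W W' : BalTensor (homAct η) (leftActTT (f := f))}
    (hW : ∀ ψ, coord₂ η ψ W = coord₂ η ψ W') : W = W' := by
  -- `J i` is `m ⊗ t ↦ m ⊗ (t ⊗ e i)`, and the `J i` recover `W` from its images `coord₂ (γ i) W`.
  let J (i : I) : BalTensor (homAct η) (antiAct (target f)) →ₗ[k]
      BalTensor (homAct η) (leftActTT (f := f)) :=
    BalTensor.map LinearMap.id (BalTensor.tmulLeft (homAct (source f)) (antiAct (target f)) (e i))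
      (fun _ _ => rfl) (fun _ _ => rfl)
  have key : ∀ W, HasFinsum (fun i => J i (coord₂ η (γ i) W)) W := fun W =>
    BalTensor.hasFinsum_of_tmul (L := fun i => J i ∘ₗ coord₂ η (γ i)) (L' := LinearMap.id)
      (fun m Z => ((h.hasFinsum_coord (source f) Z).map
        (BalTensor.tmulRight (homAct η) (leftActTT (f := f)) m)).congr (fun i => rfl) rfl) W
  exact (key W).unique ((key W').congr (fun i => by rw [hW]) rfl)

end Coord

/-! ### Algebras with an action of the bimodule endomorphisms -/

/-- An algebra `M` over `R` with a compatible action of the algebra `End _B A_B`, as it exists on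
`A` and, through the second tensor factor, on `T = (A ⊗_B A)^B`. The coaction `δ` on `M` is to be
determined by its coordinates `coord ψ (δ m) = act ψ m`; the laws below are the images under the
coordinates of `r m₀ ⊗ m₁ = m₀ ⊗ t(r) m₁`, of right `R`-linearity and of `δ(1) = 1 ⊗ 1`. -/
structure EndoAction (f : B →ₐ[k] A) (M : Type*) [Ring M] [Algebra k M] where
  /-- the algebra homomorphism `R → M` -/
  η : Cent f →ₐ[k] M
  /-- the action of `End _B A_B` on `M` -/
  act : bimodEnd f →ₐ[k] Module.End k M
  act_leftMul : ∀ r m, act (leftMul r) m = η r * m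
  act_rightMul : ∀ r m, act (rightMul r) m = m * η r
  act_one_right : ∀ ψ, act ψ 1 = η (coeffT ψ 1)

namespace EndoAction

variable {M : Type*} [Ring M] [Algebra k M] {E : EndoAction f M}
  {I : Type*} {γ : I → bimodEnd f} {e : I → TAlg f}

/-- The action on `M` satisfies the expansion `ψ(m n) = ∑ γ_i(m) (e_i¹ ψ(e_i² n))`, which holds for
`M = A` and a quasibase `(γ, e)` because `1 ⊗ m = ∑ γ_i(m) e_i`. The case `n = 1` gives the
coordinates of the coaction `∑ γ_i(m) ⊗ e_i`, and the general case its multiplicativity. -/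
structure Adapted (E : EndoAction f M) (γ : I → bimodEnd f) (e : I → TAlg f) : Prop where
  finite : ∀ m, {i | E.act (γ i) m ≠ 0}.Finite
  hasFinsum_mul : ∀ ψ m n,
    HasFinsum (fun i => E.act (γ i) m * E.act (twist ψ (e i)) n) (E.act ψ (m * n))

variable (E) in
/-- The tensor product `M ⊗_R T`. -/
abbrev Tens := BalTensor (homAct E.η) (antiAct (target f))

namespace Adapted

theorem tmul_finite (h : E.Adapted γ e) (m : M) : (Function.support fun i =>
    (BalTensor.tmul (homAct E.η) (antiAct (target f)) (E.act (γ i) m) (e i))).Finite :=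
  (h.finite m).subset fun i hi hc => hi (by
    change BalTensor.tmulLeft _ _ (e i) (E.act (γ i) m) = 0
    rw [hc, map_zero])

/-- The coaction `m ↦ ∑ γ_i(m) ⊗ e_i`. -/
def coaction (h : E.Adapted γ e) : M →ₗ[k] E.Tens where
  toFun m := ∑ᶠ i, BalTensor.tmul _ _ (E.act (γ i) m) (e i)
  map_add' m m' := by
    rw [← finsum_add_distrib (h.tmul_finite m) (h.tmul_finite m')]
    refine finsum_congr fun i => ?_
    rw [map_add]
    exact (BalTensor.tmulLeft _ _ (e i)).map_add _ _
  map_smul' c m := by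
    rw [RingHom.id_apply, smul_finsum' c (h.tmul_finite m)]
    refine finsum_congr fun i => ?_
    rw [map_smul]
    exact (BalTensor.tmulLeft _ _ (e i)).map_smul _ _

theorem hasFinsum_coaction (h : E.Adapted γ e) (m : M) :
    HasFinsum (fun i => BalTensor.tmul _ _ (E.act (γ i) m) (e i)) (h.coaction m) :=
  .of_finite (h.tmul_finite m)

theorem act_twist_one (ψ : bimodEnd f) (t : TAlg f) : E.act (twist ψ t) 1 = E.η (coeffT ψ t) := by
  rw [act_one_right, coeffT_twist, mul_one]

/-- The coordinates of the coaction do not involve the quasibase. -/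
theorem coord_coaction (h : E.Adapted γ e) (ψ : bimodEnd f) (m : M) :
    coord E.η ψ (h.coaction m) = E.act ψ m :=
  ((h.hasFinsum_coaction m).map (coord E.η ψ)).unique
    ((h.hasFinsum_mul ψ m 1).congr (fun i => by rw [act_twist_one, coord_tmul]) (by rw [mul_one]))

end Adapted

/-! ### The comodule algebra axioms -/

theorem act_leftMul_mul (r : Cent f) (ψ : bimodEnd f) (m : M) :
    E.act (leftMul r * ψ) m = E.η r * E.act ψ m := by
  rw [map_mul, Module.End.mul_apply, act_leftMul]

theorem act_mul_rightMul (r : Cent f) (ψ : bimodEnd f) (m : M) :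
    E.act (ψ * rightMul r) m = E.act ψ (m * E.η r) := by
  rw [map_mul, Module.End.mul_apply, act_rightMul]

/-- The right action of `R` on `M ⊗_R T`. -/
abbrev rightActMT (η : Cent f →ₐ[k] M) (r : Cent f) := BalTensor.rightAct (homAct η)
  (antiAct (target f)) (homAct (source f)) (act_comm source_comm_target) r

theorem coord_rightAct (η : Cent f →ₐ[k] M) (ψ : bimodEnd f) (r : Cent f)
    (Z : BalTensor (homAct η) (antiAct (target f))) :
    coord η ψ (rightActMT η r Z) = coord η (ψ * rightMul r) Z :=
  LinearMap.congr_fun (f := coord η ψ ∘ₗ rightActMT η r) (g := coord η (ψ * rightMul r))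
    (BalTensor.hom_ext fun m t => by
      simp only [LinearMap.comp_apply, BalTensor.rightAct_tmul, coord_tmul, coeffT_homAct]) Z

/-- The map `m ⊗ t ↦ m (t¹ ψ(t² n))` from `M ⊗_R T` to `M`, where the endomorphism
`twist ψ t : y ↦ t¹ ψ(t² y)` acts on `n ∈ M`. -/
def mulTwist (E : EndoAction f M) (ψ : bimodEnd f) (n : M) : E.Tens →ₗ[k] M :=
  BalTensor.lift (TensorProduct.lift ((LinearMap.mul k M).compl₂
      (LinearMap.applyₗ n ∘ₗ E.act.toLinearMap ∘ₗ twist ψ))) (fun r m t => by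
    simp [homAct, twist_antiAct, act_leftMul, mul_assoc])

namespace Adapted

variable (h : E.Adapted γ e)

theorem coaction_right (hq : IsRightQuasibase f γ e) (r : Cent f) (m : M) :
    h.coaction (homAct E.η r m) = rightActMT E.η r (h.coaction m) :=
  hq.coord_ext _ fun ψ => by
    rw [coord_rightAct, coord_coaction, coord_coaction, act_mul_rightMul]
    rfl

theorem coaction_one (hq : IsRightQuasibase f γ e) : h.coaction 1 = BalTensor.tmul _ _ 1 1 :=
  hq.coord_ext _ fun ψ => by rw [coord_coaction, coord_tmul, act_one_right, one_mul]

theorem coaction_takeuchi (hq : IsRightQuasibase f γ e) (r : Cent f) (m : M) :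
    BalTensor.map (α' := homAct E.η) (β' := antiAct (target f)) (LinearMap.mulLeft k (E.η r))
      LinearMap.id (fun _ _ => (mul_assoc _ _ _).symm) (fun _ _ => rfl) (h.coaction m) =
    BalTensor.map (α' := homAct E.η) (β' := antiAct (target f)) LinearMap.id
      (LinearMap.mulLeft k (target f r).unop) (fun _ _ => rfl) (fun _ _ => (mul_assoc _ _ _).symm)
      (h.coaction m) := by
  refine hq.coord_ext _ fun ψ => ?_
  -- Both coordinates are equal to `r ψ(m)`.
  have h1 := LinearMap.congr_fun (f := coord E.η ψ ∘ₗ BalTensor.map (α' := homAct E.η)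
      (β' := antiAct (target f)) (LinearMap.mulLeft k (E.η r))
      LinearMap.id (fun _ _ => (mul_assoc _ _ _).symm) (fun _ _ => rfl))
    (g := LinearMap.mulLeft k (E.η r) ∘ₗ coord E.η ψ)
    (BalTensor.hom_ext fun m t => mul_assoc _ _ _) (h.coaction m)
  have h2 := LinearMap.congr_fun (f := coord E.η ψ ∘ₗ BalTensor.map (α' := homAct E.η)
      (β' := antiAct (target f)) LinearMap.id
      (LinearMap.mulLeft k (target f r).unop) (fun _ _ => rfl) (fun _ _ => (mul_assoc _ _ _).symm))
    (g := coord E.η (leftMul r * ψ))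
    (BalTensor.hom_ext fun m t =>
      congrArg (fun r => m * E.η r) (coeffT_target_mul ψ r t)) (h.coaction m)
  refine h1.trans (Eq.trans ?_ h2.symm)
  rw [LinearMap.comp_apply, coord_coaction, coord_coaction, act_leftMul_mul,
    LinearMap.mulLeft_apply]

/-- The `ψ`-coordinate of `m₀ n₀ ⊗ m₁ n₁` is `m₀ (m₁¹ ψ(m₁² n))`, which the expansion of
`EndoAction.Adapted` identifies with `ψ(m n)`. -/
theorem coaction_mul (hq : IsRightQuasibase f γ e) (m n : M) (X Y : M ⊗[k] TAlg f)
    (hX : BalTensor.mk _ _ X = h.coaction m) (hY : BalTensor.mk _ _ Y = h.coaction n) :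
    h.coaction (m * n) = BalTensor.mk _ _ (X * Y) := by
  refine hq.coord_ext _ fun ψ => ?_
  have h1 (x : M) (t : TAlg f) (Y : M ⊗[k] TAlg f) :
      coord E.η ψ (BalTensor.mk _ _ (x ⊗ₜ t * Y)) =
        x * coord E.η (twist ψ t) (BalTensor.mk _ _ Y) := by
    induction Y with
    | zero => simp
    | tmul y u =>
      rw [Algebra.TensorProduct.tmul_mul_tmul]
      change x * y * E.η (coeffT ψ (t * u)) = x * (y * E.η (coeffT (twist ψ t) u))
      rw [mul_assoc, coeffT_twist]
    | add Y Y' hY hY' => simp only [mul_add, map_add, hY, hY']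
  have h2 (X : M ⊗[k] TAlg f) : coord E.η ψ (BalTensor.mk _ _ (X * Y)) =
      E.mulTwist ψ n (BalTensor.mk _ _ X) := by
    induction X with
    | zero => simp
    | tmul x t =>
      rw [h1, hY, coord_coaction]
      rfl
    | add X X' hX hX' => simp only [add_mul, map_add, hX, hX']
  rw [h2, hX, coord_coaction]
  exact (h.hasFinsum_mul ψ m n).unique ((h.hasFinsum_coaction m).map (E.mulTwist ψ n))

end Adapted
end EndoAction

variable {I : Type*} {γ : I → bimodEnd f} {e : I → TAlg f}

/-! ### The actions on `A` and on `(A ⊗_B A)^B` -/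

variable (f) in
/-- The tautological action of `End _B A_B` on `A`. -/
def actionA : EndoAction f A where
  η := (Cent f).val
  act := (bimodEnd f).val
  act_leftMul _ _ := rfl
  act_rightMul _ _ := rfl
  act_one_right ψ := by
    change ψ.1 1 = coeff ψ (tmul f 1 1)
    simp

theorem actionA_act (ψ : bimodEnd f) (a : A) : (actionA f).act ψ a = ψ.1 a := rfl

theorem IsRightQuasibase.adapted_actionA (h : IsRightQuasibase f γ e) :
    (actionA f).Adapted γ e where
  finite := h.1
  hasFinsum_mul ψ a b := ((h.hasFinsum_tmul 1 a).map (coeff ψ ∘ₗ rmul b)).congr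
    (fun i => by simp [actionA_act, ← lmul_rmul, coeff_lmul]) (by simp [actionA_act])

/-- `t ↦ t¹ ⊗ ψ(t²)` as a linear map. -/
def applyRightₗ (ψ : bimodEnd f) : TAlg f →ₗ[k] TAlg f where
  toFun := applyRight ψ
  map_add' t t' := val_injective (by
    change mapRight ψ (t + t').val = mapRight ψ t.val + mapRight ψ t'.val
    simp)
  map_smul' c t := val_injective (by
    change mapRight ψ (c • t).val = c • mapRight ψ t.val
    simp)

theorem applyRight_val (ψ : bimodEnd f) (t : TAlg f) :
    (applyRight ψ t).val = mapRight ψ t.val := rfl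

theorem mapRight_mul (ψ χ : bimodEnd f) (z : Sq f) :
    mapRight (ψ * χ) z = mapRight ψ (mapRight χ z) :=
  LinearMap.congr_fun (f := mapRight (ψ * χ)) (g := mapRight ψ ∘ₗ mapRight χ)
    (hom_ext fun x y => by simp) z

theorem mapRight_add (ψ χ : bimodEnd f) (z : Sq f) :
    mapRight (ψ + χ) z = mapRight ψ z + mapRight χ z :=
  LinearMap.congr_fun (f := mapRight (ψ + χ)) (g := mapRight ψ + mapRight χ)
    (hom_ext fun x y => by simp [tmul_add]) z

theorem mapRight_smul (c : k) (ψ : bimodEnd f) (z : Sq f) :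
    mapRight (c • ψ) z = c • mapRight ψ z :=
  LinearMap.congr_fun (f := mapRight (c • ψ)) (g := c • mapRight ψ)
    (hom_ext fun x y => by simp [tmul_smul]) z

theorem mapRight_one (z : Sq f) : mapRight 1 z = z :=
  LinearMap.congr_fun (f := mapRight 1) (g := LinearMap.id)
    (hom_ext fun x y => by simp) z

variable (f) in
/-- The action of `End _B A_B` on `T` through the second tensor factor. -/
def actionT : EndoAction f (TAlg f) where
  η := source f
  act := AlgHom.ofLinearMap
    { toFun := applyRightₗ
      map_add' ψ χ := LinearMap.ext fun t => val_injective (mapRight_add ψ χ t.val)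
      map_smul' c ψ := LinearMap.ext fun t => val_injective (mapRight_smul c ψ t.val) }
    (LinearMap.ext fun t => val_injective (mapRight_one t.val))
    (fun ψ χ => LinearMap.ext fun t => val_injective (mapRight_mul ψ χ t.val))
  act_leftMul r t := val_injective (source_mul_val t r).symm
  act_rightMul r t := val_injective (by
    rw [mul_source_val]
    change mapRight (rightMul r) t.val = _
    exact LinearMap.congr_fun (hom_ext fun x y => by simp [rightMul_apply]) t.val)
  act_one_right ψ := val_injective (by
    rw [source_val]
    change tmul f 1 (ψ.1 1) = tmul f 1 (coeff ψ (tmul f 1 1))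
    simp)

theorem actionT_act (ψ : bimodEnd f) (t : TAlg f) : (actionT f).act ψ t = applyRight ψ t := rfl

theorem IsRightQuasibase.adapted_actionT (h : IsRightQuasibase f γ e) :
    (actionT f).Adapted γ e where
  finite := h.applyRight_finite
  hasFinsum_mul ψ t u := by
    refine .of_map_injective val_injective ?_
    -- In `A ⊗_B A` this is the expansion for `A`, applied to the second tensor factor of `t`.
    have key (x y : A) (z : Sq f) : HasFinsum
        (fun i => lmul x (rmul (coeff ψ (rmul y (e i).val)) (mapRight (γ i) z)))
        (mapRight ψ (lmul x (rmul y z))) :=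
      BalTensor.hasFinsum_of_tmul
        (L := fun i => lmul x ∘ₗ rmul (coeff ψ (rmul y (e i).val)) ∘ₗ mapRight (γ i))
        (L' := mapRight ψ ∘ₗ lmul x ∘ₗ rmul y)
        (fun p q => (h.adapted_actionA.hasFinsum_mul ψ q y).map
          (BalTensor.tmulRight _ _ (x * p))) z
    exact (BalTensor.hasFinsum_of_tmul
      (L := fun i => sandwich (applyRight (γ i) t) ∘ₗ mapRight (twist ψ (e i)))
      (L' := mapRight ψ ∘ₗ sandwich t) (fun x y => key x y t.val)) u.val

/-! ### Coassociativity -/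

section Coassoc

theorem IsRightQuasibase.comul_antiAct (hq : IsRightQuasibase f γ e) (r : Cent f) (t : TAlg f) :
    hq.adapted_actionT.coaction (antiAct (target f) r t) =
      leftActTT r (hq.adapted_actionT.coaction t) :=
  hq.coord_ext (source f) fun ψ => by
    refine (hq.adapted_actionT.coord_coaction ψ _).trans (Eq.trans (val_injective ?_)
      ((coord_source_leftAct ψ r _).trans (congrArg (antiAct (target f) r)
        (hq.adapted_actionT.coord_coaction ψ t))).symm)
    rw [antiAct_val, actionT_act, actionT_act, applyRight_val, applyRight_val, antiAct_val,
      mapRight_lmul]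

variable {M : Type*} [Ring M] [Algebra k M] {E : EndoAction f M}

/-- Coassociativity holds because both sides have the coordinates `δ(γ(m)) = m₀ ⊗ γ(m₁)`, where
`γ ∈ End _B A_B`. The comultiplication of `T` is the coaction for `M = T`. -/
theorem EndoAction.Adapted.coaction_coassoc (h : E.Adapted γ e) (hq : IsRightQuasibase f γ e)
    (m : M) :
    BalTensor.assoc (homAct E.η) (antiAct (target f)) (homAct (source f)) (antiAct (target f))
      (act_comm source_comm_target)
      (BalTensor.map
        (α' := EndoAction.rightActMT E.η) (β' := antiAct (target f))
        h.coaction LinearMap.id (h.coaction_right hq) (fun _ _ => rfl) (h.coaction m)) =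
    BalTensor.map (α' := homAct E.η) (β' := leftActTT)
      LinearMap.id hq.adapted_actionT.coaction (fun _ _ => rfl) hq.comul_antiAct
      (h.coaction m) := by
  refine hq.coord₂_ext _ fun ψ => ?_
  -- `V` is `m ⊗ t ↦ m ⊗ ψ(t)`; the two sides are mapped to `δ(ψ(m))` and `V (δ(m))`.
  let V : E.Tens →ₗ[k] E.Tens := BalTensor.map LinearMap.id (applyRightₗ ψ) (fun _ _ => rfl)
    (fun r t => val_injective (by
      change mapRight ψ (antiAct (target f) r t).val = _
      rw [antiAct_val, antiAct_val, mapRight_lmul]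
      rfl))
  have h1 : coord₂ E.η ψ ∘ₗ BalTensor.assoc (homAct E.η) (antiAct (target f))
      (homAct (source f)) (antiAct (target f)) (act_comm source_comm_target) ∘ₗ BalTensor.map
        (α' := EndoAction.rightActMT E.η) (β' := antiAct (target f))
        h.coaction LinearMap.id (h.coaction_right hq) (fun _ _ => rfl) =
      h.coaction ∘ₗ coord E.η ψ := BalTensor.hom_ext fun x t => by
    have h2 (t : TAlg f) : (coord₂ E.η ψ ∘ₗ BalTensor.assoc (homAct E.η) (antiAct (target f))
        (homAct (source f)) (antiAct (target f)) (act_comm source_comm_target)) ∘ₗ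
          BalTensor.tmulLeft _ _ t = EndoAction.rightActMT E.η (coeffT ψ t) :=
      BalTensor.hom_ext fun y u => rfl
    refine (LinearMap.congr_fun (h2 t) (h.coaction x)).trans ?_
    exact (h.coaction_right hq _ x).symm
  have h3 : coord₂ E.η ψ ∘ₗ BalTensor.map (α' := homAct E.η) (β' := leftActTT)
      LinearMap.id hq.adapted_actionT.coaction (fun _ _ => rfl) hq.comul_antiAct = V :=
    BalTensor.hom_ext fun x t =>
      congrArg (BalTensor.tmul _ _ x) (hq.adapted_actionT.coord_coaction ψ t)
  refine (LinearMap.congr_fun h1 (h.coaction m)).trans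
    (Eq.trans ?_ (LinearMap.congr_fun h3 (h.coaction m)).symm)
  refine hq.coord_ext _ fun χ => ?_
  have h4 : coord E.η χ ∘ₗ V = coord E.η (χ * ψ) := BalTensor.hom_ext fun x t =>
    congrArg (fun r => x * E.η r) (Subtype.ext (coeff_mul χ ψ t.val).symm)
  refine Eq.trans ?_ (LinearMap.congr_fun h4 (h.coaction m)).symm
  rw [LinearMap.comp_apply, coord_coaction, coord_coaction, coord_coaction, map_mul]
  rfl

end Coassoc

/-! ### The bialgebroid and its coaction on `A` -/

/-- The counit `coeffT 1 : t ↦ t¹ t²` is right `R`-linear. -/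
theorem coeffT_one_homAct (r : Cent f) (t : TAlg f) :
    coeffT 1 (homAct (source f) r t) = coeffT 1 t * r :=
  Subtype.ext (by
    change coeff 1 (homAct (source f) r t).val = coeff 1 t.val * r
    rw [homAct_val, coeff_one, coeff_one, mu_rmul])

theorem IsRightQuasibase.counit_comul (hq : IsRightQuasibase f γ e) (t : TAlg f) :
    counitLeft (source f) (target f) (coeffT 1)
      coeffT_one_homAct (hq.adapted_actionT.coaction t) = t := by
  refine ((hq.adapted_actionT.hasFinsum_coaction t).map (counitLeft (source f) (target f) (coeffT 1)
    _)).unique ((hq.hasFinsum_TAlg t).congr (fun i => ?_) rfl)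
  exact congrArg (fun r => antiAct (target f) r (e i)) (Subtype.ext (coeff_one _).symm)

/-- The right bialgebroid `(A ⊗_B A)^B` over the centralizer of `B` in `A`. -/
def IsRightQuasibase.bialgebroid (hq : IsRightQuasibase f γ e) :
    RightBialgebroid k (Cent f) (TAlg f) where
  s := source f
  t := target f
  s_comm_t := source_comm_target
  comul := hq.adapted_actionT.coaction
  counit := coeffT 1
  comul_left := hq.comul_antiAct
  comul_right := hq.adapted_actionT.coaction_right hq
  counit_left := coeffT_antiAct 1
  counit_right := coeffT_one_homAct
  counit_comul := hq.counit_comul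
  comul_counit t := (hq.adapted_actionT.coord_coaction 1 t).trans (by rw [map_one]; rfl)
  coassoc := hq.adapted_actionT.coaction_coassoc hq
  takeuchi := hq.adapted_actionT.coaction_takeuchi hq
  comul_one := hq.adapted_actionT.coaction_one hq
  comul_mul := hq.adapted_actionT.coaction_mul hq
  counit_one := Subtype.ext (by simp [val_one])
  counit_mul_s t u := Subtype.ext (by
    simp only [coe_coeffT, val_mul]
    exact LinearMap.congr_fun (f := coeff 1 ∘ₗ sandwich t) (g := coeff 1 ∘ₗ sandwich _)
      (hom_ext fun x y => by simp [source_val, coeff_one, mu_lmul, mu_rmul]) u.val)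
  counit_mul_t t u := Subtype.ext (by
    simp only [coe_coeffT, val_mul]
    exact LinearMap.congr_fun (f := coeff 1 ∘ₗ sandwich t) (g := coeff 1 ∘ₗ sandwich _)
      (hom_ext fun x y => by simp [target_val, coeff_one, mu_lmul, mu_rmul, mul_assoc]) u.val)

/-- The coaction `A → A ⊗_R (A ⊗_B A)^B`. -/
def IsRightQuasibase.comoduleAlgebra (hq : IsRightQuasibase f γ e) :
    hq.bialgebroid.ComoduleAlgebra A where
  η := (Cent f).val
  coact := hq.adapted_actionA.coaction
  coact_right := hq.adapted_actionA.coaction_right hq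
  coact_counit a := hq.adapted_actionA.coord_coaction 1 a
  coassoc := hq.adapted_actionA.coaction_coassoc hq
  coact_one := hq.adapted_actionA.coaction_one hq
  takeuchi := hq.adapted_actionA.coaction_takeuchi hq
  coact_mul := hq.adapted_actionA.coaction_mul hq

/-- The coaction attached to one quasibase is given by the same formula in any other quasibase. -/
theorem EndoAction.Adapted.coaction_eq_finsum {M : Type*} [Ring M] [Algebra k M]
    {E : EndoAction f M} (h : E.Adapted γ e) (hq : IsRightQuasibase f γ e)
    {I' : Type*} {γ' : I' → bimodEnd f} {e' : I' → TAlg f} (h' : E.Adapted γ' e') (m : M) :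
    h.coaction m = ∑ᶠ i, BalTensor.tmul (homAct E.η) (antiAct (target f))
      (E.act (γ' i) m) (e' i) :=
  hq.coord_ext E.η (Z' := h'.coaction m) fun ψ => by rw [coord_coaction, coord_coaction]

/-- A module with a dual basis is projective. -/
theorem projective_of_hasFinsum {R T : Type*} [Ring R] [AddCommGroup T] [Module R T]
    (φ : I → T →ₗ[R] R) {e : I → T} (hfin : ∀ t, (Function.support fun i => φ i t).Finite)
    (h : ∀ t, HasFinsum (fun i => φ i t • e i) t) : Module.Projective R T := by
  let Φ : T →ₗ[R] I →₀ R :=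
    { toFun t := Finsupp.ofSupportFinite (fun i => φ i t) (hfin t)
      map_add' t t' := Finsupp.ext fun i => map_add (φ i) t t'
      map_smul' r t := Finsupp.ext fun i => map_smul (φ i) r t }
  refine Module.Projective.of_split Φ (Finsupp.linearCombination R e) (LinearMap.ext fun t => ?_)
  rw [LinearMap.comp_apply, Finsupp.linearCombination_apply]
  exact (HasFinsum.of_finsupp (Φ t) (L := fun i r => r • e i) fun i => zero_smul R (e i)).unique
    (h t)

theorem IsRightQuasibase.leftProjective (hq : IsRightQuasibase f γ e) :
    hq.bialgebroid.LeftProjective := by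
  let _ : Module (Cent f) (TAlg f) := Module.compHom (TAlg f) (target f : Cent f →+* (TAlg f)ᵐᵒᵖ)
  exact projective_of_hasFinsum (R := Cent f) (T := TAlg f)
    (fun i => { toFun := coeffT (γ i)
                map_add' := map_add (coeffT (γ i))
                map_smul' := coeffT_antiAct (γ i) })
    (fun t => (hq.applyRight_finite t).subset fun i hi hc => hi (Subtype.ext (by
      change mu f (applyRight (γ i) t).val = 0
      rw [hc, map_zero, map_zero]))) hq.hasFinsum_TAlg

/-! ### The Galois property -/

/-- The map `a ⊗ t ↦ a t¹ ⊗ t²`, inverse to the canonical map. -/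
def evalMap (f : B →ₐ[k] A) : (actionA f).Tens →ₗ[k] Sq f :=
  BalTensor.lift (TensorProduct.lift (LinearMap.mk₂ k (fun a t => lmul a (val t))
      (fun _ _ _ => by simp [lmul_add]) (fun _ _ _ => by simp [lmul_smul])
      (fun _ _ _ => by simp) (fun _ _ _ => by simp)))
    (fun r a t => by
      simp only [TensorProduct.lift.tmul, LinearMap.mk₂_apply, antiAct_val, ← lmul_mul]
      rfl)

theorem evalMap_tmul (a : A) (t : TAlg f) :
    evalMap f (BalTensor.tmul _ _ a t) = lmul a t.val := rfl

/-- Since `evalMap` is injective, this determines the coaction: `δ(a)` corresponds to `1 ⊗ a`. -/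
theorem IsRightQuasibase.evalMap_coaction (hq : IsRightQuasibase f γ e) (a : A) :
    evalMap f (hq.adapted_actionA.coaction a) = tmul f 1 a :=
  ((hq.adapted_actionA.hasFinsum_coaction a).map (evalMap f)).unique
    ((hq.hasFinsum_tmul 1 a).congr (fun i => by rw [one_mul, evalMap_tmul]; rfl) rfl)

theorem coord_eq_coeff_evalMap (ψ : bimodEnd f) (Z : (actionA f).Tens) :
    coord (actionA f).η ψ Z = coeff ψ (evalMap f Z) :=
  LinearMap.congr_fun (g := coeff ψ ∘ₗ evalMap f) (BalTensor.hom_ext fun a t => by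
    rw [LinearMap.comp_apply, evalMap_tmul, coord_tmul, coeff_lmul]
    rfl) Z

theorem IsRightQuasibase.evalMap_injective (hq : IsRightQuasibase f γ e) :
    Function.Injective (evalMap f) := fun Z Z' h =>
  hq.coord_ext _ fun ψ => by rw [coord_eq_coeff_evalMap, coord_eq_coeff_evalMap, h]

/-- If `1 ⊗ x = x ⊗ 1`, then right multiplication by `x` commutes with `End A_B`, so balancedness
puts `x` in the image of `B`. -/
theorem IsRightBalanced.mem_range (hb : IsRightBalanced f) {x : A}
    (hx : tmul f 1 x = tmul f x 1) : x ∈ Set.range f := by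
  obtain ⟨b, hb⟩ := hb
    { toFun a := a * x
      map_add' a a' := add_mul a a' x
      map_smul' F a := by
        have hF (b : B) (a : A) : F.1 (a * f b) = F.1 a * f b :=
          (LinearMap.congr_fun (F.2 _ ⟨b, rfl⟩) a).symm
        -- Apply `y ⊗ y' ↦ F(y) y'` to `a ⊗ x = a x ⊗ 1`.
        let G : Sq f →ₗ[k] A := BalTensor.lift
          (LinearMap.mul' k A ∘ₗ TensorProduct.map F.1 LinearMap.id)
          (fun b a a' => by simp [hF, mul_assoc])
        have := congrArg (fun z => G (lmul a z)) hx
        change F.1 (a * 1) * x = F.1 (a * x) * 1 at this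
        rw [mul_one, mul_one] at this
        exact this }
  exact ⟨b, by simpa using (hb 1).symm⟩

theorem IsRightQuasibase.isGalois (hq : IsRightQuasibase f γ e) (hb : IsRightBalanced f) :
    hq.comoduleAlgebra.IsGalois f := by
  have hmem (x : A) : x ∈ hq.comoduleAlgebra.coinvariants ↔ tmul f 1 x = tmul f x 1 := by
    have h1 : evalMap f (BalTensor.tmul _ _ x 1) = tmul f x 1 := by
      rw [evalMap_tmul, val_one, lmul_tmul, mul_one]
    rw [← hq.evalMap_coaction, ← h1, hq.evalMap_injective.eq_iff]
    rfl
  have hrange : Set.range f = hq.comoduleAlgebra.coinvariants := by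
    refine Set.Subset.antisymm ?_ fun x hx => hb.mem_range ((hmem x).1 hx)
    rintro _ ⟨b, rfl⟩
    rw [hmem]
    simpa using (tmul_bal (f := f) b 1 1).symm
  refine ⟨hrange, ?_⟩
  have hinv : evalMap f ∘ₗ hq.comoduleAlgebra.canonicalMap f (fun b => hrange ▸ ⟨b, rfl⟩) =
      LinearMap.id := hom_ext fun x y => by
    have h1 : evalMap f ∘ₗ hq.comoduleAlgebra.lmul x = lmul x ∘ₗ evalMap f :=
      BalTensor.hom_ext fun a t => lmul_mul x a t.val
    refine (LinearMap.congr_fun h1 _).trans ?_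
    refine (congrArg (lmul x) (hq.evalMap_coaction y)).trans ?_
    simp
  have hl := LinearMap.congr_fun hinv
  exact ⟨Function.LeftInverse.injective hl, fun Z => ⟨evalMap f Z, hq.evalMap_injective (hl _)⟩⟩

end AlgExt

/-! ### Depth two and dual bases -/

namespace AlgExt

variable {k : Type w} {A : Type u} {B : Type v} [CommRing k] [Ring A] [Algebra k A]
  [Ring B] [Algebra k B] {f : B →ₐ[k] A}

open TAlg

/-- Functionals on the `A`-`B`-bimodule `A ⊗_B A` with a dual family of `B`-central elements give
the quasibase `γ_i(y) = φ_i(1 ⊗ y)`. -/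
theorem exists_isRightQuasibase {I : Type*} (φ : I → Sq f →ₗ[k] A) (e : I → TAlg f)
    (hφl : ∀ i a z, φ i (lmul a z) = a * φ i z)
    (hφr : ∀ i b z, φ i (rmul (f b) z) = φ i z * f b)
    (hfin : ∀ z, (Function.support fun i => φ i z).Finite)
    (h : ∀ z, HasFinsum (fun i => lmul (φ i z) (e i).val) z) :
    ∃ γ : I → bimodEnd f, IsRightQuasibase f γ e := by
  let γ (i : I) : bimodEnd f := ⟨φ i ∘ₗ rmulAt (tmul f 1 1), mem_bimodEnd
    (fun b y => by
      have := tmul_bal (f := f) b 1 y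
      rw [one_mul] at this
      simp only [LinearMap.comp_apply, rmulAt_apply, rmul_tmul, one_mul]
      rw [← this, ← hφl, lmul_tmul, mul_one])
    (fun b y => by simp only [LinearMap.comp_apply, rmulAt_apply, rmul_mul, hφr])⟩
  refine ⟨γ, fun a => hfin _, fun x y => ?_⟩
  have hγ (i : I) : φ i (tmul f x y) = x * (γ i).1 y := by
    change _ = x * φ i (tmul f 1 (1 * y))
    rw [← hφl, lmul_tmul, mul_one, one_mul]
  simpa only [hγ] using (h (tmul f x y)).finsum_eq.symm

/-- The projection of `A^(I)` onto its direct summand `A ⊗_B A` maps the standard basis to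
`B`-central elements, which are dual to the components of `A ⊗_B A → A^(I)`. -/
theorem IsRightDepthTwo.exists_quasibase (h : IsRightDepthTwo f) :
    ∃ (I : Type u) (γ : I → bimodEnd f) (e : I → TAlg f), IsRightQuasibase f γ e := by
  obtain ⟨I, P, Q, e, hP, hQ, hPQ, hl, hr⟩ := h
  let π : (I →₀ A) →ₗ[k] Sq f := e.symm.toLinearMap ∘ₗ P.projectionOnto Q hPQ
  have hπe (z : Sq f) : π (e z) = z := by
    simp [π]
  -- An endomorphism preserving `P` and `Q` commutes with the projection onto `P`.
  have hπ (σ : Module.End k (I →₀ A)) (σ' : Module.End k (Sq f)) (h1 : ∀ z ∈ P, σ z ∈ P)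
      (h2 : ∀ z ∈ Q, σ z ∈ Q) (h3 : ∀ z, (e (σ' z) : I →₀ A) = σ (e z)) (z : I →₀ A) :
      π (σ z) = σ' (π z) := by
    have hz : z - e (π z) ∈ Q := by
      simpa [π] using Submodule.sub_projection_mem hPQ z
    have h4 : π (σ (z - e (π z))) = 0 := by
      change e.symm _ = 0
      rw [(Submodule.projectionOnto_apply_eq_zero_iff hPQ).2 (h2 _ hz), map_zero]
    rw [map_sub, map_sub, ← h3, hπe, sub_eq_zero] at h4
    exact h4
  have hπl (a : A) (z : I →₀ A) : π (a • z) = lmul a (π z) :=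
    hπ (DistribSMul.toLinearMap k (I →₀ A) a) (lmul a)
      (fun z hz => (hP z hz).1 a) (fun z hz => (hQ z hz).1 a) (hl a) z
  have hπr (b : B) (z : I →₀ A) : π (MulOpposite.op (f b) • z) = rmul (f b) (π z) :=
    hπ (DistribSMul.toLinearMap k (I →₀ A) (MulOpposite.op (f b))) (rmul (f b))
      (fun z hz => (hP z hz).2 b) (fun z hz => (hQ z hz).2 b) (hr b) z
  let w (i : I) : TAlg f := ⟨π (Finsupp.single i 1), fun b => by
    rw [← hπl, ← hπr]; simp⟩
  obtain ⟨γ, hγ⟩ := exists_isRightQuasibase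
    (fun i => Finsupp.lapply i ∘ₗ P.subtype ∘ₗ e.toLinearMap) w
    (fun i a z => by simp [hl]) (fun i b z => by simp [hr])
    (fun z => (e z : I →₀ A).hasFiniteSupport)
    (fun z => by
      have h1 := HasFinsum.of_finsupp (e z : I →₀ A) (L := Finsupp.single) (by simp)
      rw [Finsupp.sum_single] at h1
      refine (h1.map π).congr (fun i => ?_) (hπe z)
      change _ = lmul _ (π _)
      rw [← hπl]
      simp)
  exact ⟨I, γ, w, hγ⟩

/-- A family of functionals on the `A`-`B`-bimodule `A ⊗_B A` with a dual family of `B`-central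
elements exhibits `A ⊗_B A` as a direct summand of a direct sum of copies of `A`. Dropping the
functionals that vanish brings the index set into the universe of `A`. -/
theorem isRightDepthTwo_of_dualBasis {J : Type y} (φ : J → Sq f →ₗ[k] A) (w : J → Sq f)
    (hφl : ∀ j a z, φ j (lmul a z) = a * φ j z)
    (hφr : ∀ j b z, φ j (rmul (f b) z) = φ j z * f b)
    (hw : ∀ j b, lmul (f b) (w j) = rmul (f b) (w j))
    (hfin : ∀ z, (Function.support fun j => φ j z).Finite)
    (h : ∀ z, HasFinsum (fun j => lmul (φ j z) (w j)) z) : IsRightDepthTwo f := by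
  -- `s` is small, as a union of finite sets indexed by `A ⊗_B A`.
  let s : Set J := ⋃ z, Function.support fun j => φ j z
  have (z : Sq f) : Small.{u} (Function.support fun j => φ j z) :=
    have := (hfin z).to_subtype
    inferInstance
  have hs : Small.{u} s := inferInstance
  let I := Shrink.{u} s
  let ι : I → J := fun i => ((equivShrink s).symm i : J)
  have hι : Function.Injective ι :=
    Subtype.val_injective.comp (equivShrink s).symm.injective
  have hrange (z : Sq f) : (Function.support fun j => φ j z) ⊆ Set.range ι := fun j hj =>
    ⟨equivShrink s ⟨j, Set.mem_iUnion.2 ⟨z, hj⟩⟩, by simp [ι]⟩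
  have hfin' (z : Sq f) : (Function.support fun i => φ (ι i) z).Finite :=
    (hfin z).preimage hι.injOn
  let enc : Sq f →ₗ[k] I →₀ A :=
    { toFun z := Finsupp.ofSupportFinite (fun i => φ (ι i) z) (hfin' z)
      map_add' z z' := Finsupp.ext fun i => map_add (φ (ι i)) z z'
      map_smul' c z := Finsupp.ext fun i => map_smul (φ (ι i)) c z }
  have henc (z : Sq f) (i : I) : enc z i = φ (ι i) z := rfl
  let dec : (I →₀ A) →ₗ[k] Sq f := Finsupp.lsum k fun i => lmulAt (w (ι i))
  have hdec_single (i : I) (a : A) : dec (Finsupp.single i a) = lmul a (w (ι i)) :=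
    Finsupp.sum_single_index (map_zero (lmulAt (w (ι i))))
  have hdl (a : A) (z : I →₀ A) : dec (a • z) = lmul a (dec z) := by
    induction z using Finsupp.induction_linear with
    | zero => simp
    | add z z' hz hz' => rw [smul_add, map_add, map_add, map_add, hz, hz']
    | single i a' => rw [Finsupp.smul_single, hdec_single, hdec_single, smul_eq_mul, lmul_mul]
  have hdr (b : B) (z : I →₀ A) : dec (MulOpposite.op (f b) • z) = rmul (f b) (dec z) := by
    induction z using Finsupp.induction_linear with
    | zero => simp
    | add z z' hz hz' => rw [smul_add, map_add, map_add, map_add, hz, hz']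
    | single i a' =>
      rw [Finsupp.smul_single, hdec_single, hdec_single, MulOpposite.smul_eq_mul_unop,
        MulOpposite.unop_op, lmul_mul, hw, lmul_rmul]
  have hinv (z : Sq f) : dec (enc z) = z :=
    (HasFinsum.of_finsupp (enc z) (L := fun i a => lmulAt (w (ι i)) a)
      (fun i => map_zero _)).unique ((h z).comp_injective hι fun j hj => hrange z fun hc => hj (by
        replace hc : φ j z = 0 := hc
        change lmulAt (w j) (φ j z) = 0
        rw [hc, map_zero]))
  have hinj : Function.Injective enc := Function.LeftInverse.injective hinv
  have hel (a : A) (z : Sq f) : enc (lmul a z) = a • enc z := Finsupp.ext fun i => by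
    rw [Finsupp.smul_apply, henc, henc, hφl, smul_eq_mul]
  have her (b : B) (z : Sq f) : enc (rmul (f b) z) = MulOpposite.op (f b) • enc z :=
    Finsupp.ext fun i => by
      rw [Finsupp.smul_apply, henc, henc, hφr, MulOpposite.smul_eq_mul_unop, MulOpposite.unop_op]
  refine ⟨I, LinearMap.range enc, LinearMap.ker dec, LinearEquiv.ofInjective enc hinj,
    ?_, ?_, ?_, hel, her⟩
  · rintro _ ⟨z, rfl⟩
    exact ⟨fun a => ⟨lmul a z, hel a z⟩, fun b => ⟨rmul (f b) z, her b z⟩⟩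
  · intro z hz
    rw [LinearMap.mem_ker] at hz
    exact ⟨fun a => by rw [LinearMap.mem_ker, hdl, hz, map_zero],
      fun b => by rw [LinearMap.mem_ker, hdr, hz, map_zero]⟩
  · have := LinearMap.isCompl_of_proj (f := enc.rangeRestrict ∘ₗ dec) (by
      rintro ⟨_, z, rfl⟩
      exact Subtype.ext (congrArg enc (hinv z)))
    rwa [LinearMap.ker_comp_of_ker_eq_bot _ (by
      rw [LinearMap.ker_rangeRestrict]; exact LinearMap.ker_eq_bot.2 hinj)] at this

end AlgExt

/-! ### Galois extensions are balanced of depth two -/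

namespace RightBialgebroid.ComoduleAlgebra

variable {k R T A B : Type*} [CommRing k] [Ring R] [Algebra k R] [Ring T] [Algebra k T]
  [Ring A] [Algebra k A] [Ring B] [Algebra k B] {D : RightBialgebroid k R T}
  (C : ComoduleAlgebra D A) {f : B →ₐ[k] A}

variable {C}

/-- If `δ(a) = a ⊗ 1`, then `η(r) a ⊗ 1 = a ⊗ t(r) = a η(r) ⊗ 1`, and the counit can be applied. -/
theorem commute_of_mem_coinvariants {a : A} (ha : a ∈ C.coinvariants) (r : R) :
    a * C.η r = C.η r * a := by
  have h1 := C.takeuchi r a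
  rw [show C.coact a = _ from ha] at h1
  have h2 := BalTensor.tmul_act (homAct C.η) (antiAct D.t) r a 1
  have h3 : BalTensor.tmul (homAct C.η) (antiAct D.t) (C.η r * a) 1 =
      BalTensor.tmul (homAct C.η) (antiAct D.t) (a * C.η r) 1 := by
    exact h1.trans (Eq.trans (congrArg (BalTensor.tmul _ _ a)
      ((mul_one _).trans (one_mul _).symm)) h2.symm)
  have h4 (a : A) : counitRight C.η D.t D.counit D.counit_left (BalTensor.tmul _ _ a 1) = a := by
    rw [counitRight, BalTensor.lift_tmul]
    simp [D.counit_one]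
  rw [← h4 (a * C.η r), ← h3, h4]

/-- The right multiplication `(a ⊗ x) b = a b ⊗ x` on `A ⊗_R T` by a coinvariant `b`. -/
def rmul {b : A} (hb : b ∈ C.coinvariants) : C.Tens →ₗ[k] C.Tens :=
  BalTensor.map (LinearMap.mulRight k b) LinearMap.id
    (fun r a => by simp [homAct, mul_assoc, commute_of_mem_coinvariants hb]) (fun _ _ => rfl)

@[simp] theorem rmul_tmul {b : A} (hb : b ∈ C.coinvariants) (a : A) (x : T) :
    rmul hb (BalTensor.tmul _ _ a x) = BalTensor.tmul _ _ (a * b) x := rfl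

theorem lmul_rmul {b : A} (hb : b ∈ C.coinvariants) (a : A) (Z : C.Tens) :
    C.lmul a (rmul hb Z) = rmul hb (C.lmul a Z) :=
  LinearMap.congr_fun (f := C.lmul a ∘ₗ rmul hb) (g := rmul hb ∘ₗ C.lmul a)
    (C.hom_ext fun x y => by simp [mul_assoc]) Z

theorem coact_mul_coinvariant {b : A} (hb : b ∈ C.coinvariants) (y : A) :
    C.coact (y * b) = rmul hb (C.coact y) := by
  obtain ⟨Y, hY⟩ := BalTensor.mk_surjective _ _ (C.coact y)
  rw [C.coact_mul y b Y (b ⊗ₜ 1) hY hb.symm, ← hY]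
  have : BalTensor.mk (homAct C.η) (antiAct D.t) ∘ₗ LinearMap.mulRight k (b ⊗ₜ[k] (1 : T)) =
      rmul hb ∘ₗ BalTensor.mk (homAct C.η) (antiAct D.t) :=
    TensorProduct.ext' fun a x => by
      simp only [LinearMap.comp_apply, LinearMap.mulRight_apply,
        Algebra.TensorProduct.tmul_mul_tmul, mul_one]
      rfl
  exact LinearMap.congr_fun this Y

variable (hf : ∀ b, f b ∈ C.coinvariants)

theorem canonicalMap_tmul (x y : A) :
    C.canonicalMap f hf (AlgExt.tmul f x y) = C.lmul x (C.coact y) := rfl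

theorem canonicalMap_lmul (a : A) (z : AlgExt.Sq f) :
    C.canonicalMap f hf (AlgExt.lmul a z) = C.lmul a (C.canonicalMap f hf z) :=
  LinearMap.congr_fun (f := C.canonicalMap f hf ∘ₗ AlgExt.lmul a)
    (g := C.lmul a ∘ₗ C.canonicalMap f hf)
    (AlgExt.hom_ext fun x y => by simp [canonicalMap_tmul, C.lmul_mul]) z

theorem canonicalMap_rmul (b : B) (z : AlgExt.Sq f) :
    C.canonicalMap f hf (AlgExt.rmul (f b) z) = rmul (hf b) (C.canonicalMap f hf z) :=
  LinearMap.congr_fun (f := C.canonicalMap f hf ∘ₗ AlgExt.rmul (f b))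
    (g := rmul (hf b) ∘ₗ C.canonicalMap f hf)
    (AlgExt.hom_ext fun x y => by
      simp [canonicalMap_tmul, coact_mul_coinvariant (hf b), lmul_rmul]) z

end RightBialgebroid.ComoduleAlgebra

/-- A dual basis of the left `R`-module `T`, with action `r · x = x t(r)`. -/
structure RightBialgebroid.DualBasis {k R T : Type*} [CommRing k] [Ring R] [Algebra k R]
    [Ring T] [Algebra k T] (D : RightBialgebroid k R T) (J : Type*) where
  /-- the functionals -/
  φ : J → T →ₗ[k] R
  /-- the elements -/
  e : J → T
  φ_left : ∀ j r x, φ j (antiAct D.t r x) = r * φ j x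
  finite : ∀ x, {j | φ j x ≠ 0}.Finite
  hasFinsum : ∀ x, HasFinsum (fun j => antiAct D.t (φ j x) (e j)) x

theorem RightBialgebroid.LeftProjective.exists_dualBasis {k R T : Type*} [CommRing k] [Ring R]
    [Algebra k R] [Ring T] [Algebra k T] {D : RightBialgebroid k R T} (h : D.LeftProjective) :
    Nonempty (D.DualBasis T) := by
  let _ : Module R T := Module.compHom T (D.t : R →+* Tᵐᵒᵖ)
  have hsmul (r : R) (x : T) : r • x = antiAct D.t r x := rfl
  obtain ⟨σ, hσ⟩ := Module.Projective.out (self := h)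
  exact ⟨{
    φ j := {
      toFun x := σ x j
      map_add' _ _ := by rw [map_add]; rfl
      map_smul' c x := by
        have : c • x = (algebraMap k R c) • x := by
          rw [hsmul]
          simp [antiAct, Algebra.smul_def, Algebra.commutes]
        rw [this, map_smul]
        simp [Algebra.smul_def] }
    e := id
    φ_left j r x := by
      change σ (r • x) j = _
      rw [map_smul]
      rfl
    finite x := (σ x).hasFiniteSupport
    hasFinsum x := by
      have := HasFinsum.of_finsupp (σ x) (L := fun (j : T) (r : R) => r • j)
        (fun j => zero_smul R j)
      exact this.congr (fun i => rfl) (hσ x) }⟩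

namespace RightBialgebroid.DualBasis

variable {k R T A B : Type*} [CommRing k] [Ring R] [Algebra k R] [Ring T] [Algebra k T]
  [Ring A] [Algebra k A] [Ring B] [Algebra k B] {D : RightBialgebroid k R T}
  {J : Type*} (d : D.DualBasis J) (C : ComoduleAlgebra D A) {f : B →ₐ[k] A}

/-- The map `a ⊗ x ↦ a η(φ_j(x))` from `A ⊗_R T` to `A`. -/
def coord (j : J) : C.Tens →ₗ[k] A := counitRight C.η D.t (d.φ j) (d.φ_left j)

theorem coord_tmul (j : J) (a : A) (x : T) :
    d.coord C j (BalTensor.tmul _ _ a x) = a * C.η (d.φ j x) := rfl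

theorem coord_lmul (j : J) (a : A) (Z : C.Tens) :
    d.coord C j (C.lmul a Z) = a * d.coord C j Z :=
  LinearMap.congr_fun (f := d.coord C j ∘ₗ C.lmul a) (g := LinearMap.mulLeft k a ∘ₗ d.coord C j)
    (C.hom_ext fun _ _ => mul_assoc _ _ _) Z

theorem coord_rmul (j : J) {b : A} (hb : b ∈ C.coinvariants) (Z : C.Tens) :
    d.coord C j (ComoduleAlgebra.rmul hb Z) = d.coord C j Z * b :=
  LinearMap.congr_fun (f := d.coord C j ∘ₗ ComoduleAlgebra.rmul hb)
    (g := LinearMap.mulRight k b ∘ₗ d.coord C j)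
    (C.hom_ext fun x y => by
      simp [coord_tmul, mul_assoc, ComoduleAlgebra.commute_of_mem_coinvariants hb]) Z

theorem coord_finite (Z : C.Tens) : {j | d.coord C j Z ≠ 0}.Finite :=
  BalTensor.finite_of_tmul (fun a x => (d.finite x).subset fun j hj hc => hj (by
    rw [coord_tmul, hc, map_zero, mul_zero])) Z

theorem hasFinsum_coord (Z : C.Tens) :
    HasFinsum (fun j => BalTensor.tmul (homAct C.η) (antiAct D.t) (d.coord C j Z) (d.e j)) Z :=
  BalTensor.hasFinsum_of_tmul
    (L := fun j => BalTensor.tmulLeft (homAct C.η) (antiAct D.t) (d.e j) ∘ₗ d.coord C j)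
    (L' := LinearMap.id)
    (fun a x => ((d.hasFinsum x).map (BalTensor.tmulRight (homAct C.η) (antiAct D.t) a)).congr
      (fun j => (BalTensor.tmul_act (homAct C.η) (antiAct D.t) _ a (d.e j)).symm) rfl) Z

theorem coord_ext {Z Z' : C.Tens} (h : ∀ j, d.coord C j Z = d.coord C j Z') : Z = Z' :=
  (d.hasFinsum_coord C Z).unique ((d.hasFinsum_coord C Z').congr (fun j => by rw [h]) rfl)

variable {C}

/-- The canonical isomorphism transports the dual basis of `T` to `A ⊗_B A`. -/
theorem isRightDepthTwo (d : D.DualBasis J) (hG : C.IsGalois f) : AlgExt.IsRightDepthTwo f := by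
  have hf (b : B) : f b ∈ C.coinvariants := hG.range_eq ▸ Set.mem_range_self b
  have hbij : Function.Bijective (C.canonicalMap f hf) := hG.bijective
  choose w hw using fun j => hbij.2 (BalTensor.tmul _ _ 1 (d.e j))
  refine AlgExt.isRightDepthTwo_of_dualBasis (fun j => d.coord C j ∘ₗ C.canonicalMap f hf) w
    (fun j a z => ?_) (fun j b z => ?_) (fun j b => hbij.1 ?_)
    (fun z => d.coord_finite C _) (fun z => .of_map_injective hbij.1 ?_)
  · rw [LinearMap.comp_apply, ComoduleAlgebra.canonicalMap_lmul, coord_lmul]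
    rfl
  · rw [LinearMap.comp_apply, ComoduleAlgebra.canonicalMap_rmul, coord_rmul]
    rfl
  · rw [ComoduleAlgebra.canonicalMap_lmul, ComoduleAlgebra.canonicalMap_rmul, hw]
    simp
  · refine (d.hasFinsum_coord C (C.canonicalMap f hf z)).congr (fun j => ?_) rfl
    rw [ComoduleAlgebra.canonicalMap_lmul, hw, ComoduleAlgebra.lmul_tmul, mul_one]
    rfl

/-- An endomorphism of the `End A_B`-module `A` is the right multiplication by some `x`. Since
`a ↦ a₀ η(φ_j(a₁))` and the right multiplications by elements of `η(R)` lie in `End A_B`, the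
elements `δ(x)` and `x ⊗ 1` have the same coordinates, so `x` is coinvariant. -/
theorem isRightBalanced (d : D.DualBasis J) (hG : C.IsGalois f) : AlgExt.IsRightBalanced f := by
  intro F
  have hf (b : B) : f b ∈ C.coinvariants := hG.range_eq ▸ Set.mem_range_self b
  have hF (G : Module.End k A) (hG : ∀ b a, G (a * f b) = G a * f b) (a : A) :
      F (G a) = G (F a) := by
    have hmem : G ∈ AlgExt.rightEnd f := by
      rintro _ ⟨b, rfl⟩
      exact LinearMap.ext fun a => (hG b a).symm
    exact map_smul F (⟨G, hmem⟩ : AlgExt.rightEnd f) a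
  have hF1 (a : A) : F a = a * F 1 := by
    simpa using hF (LinearMap.mulLeft k a) (fun b y => by simp [mul_assoc]) 1
  have hη (r : R) : F 1 * C.η r = C.η r * F 1 := by
    have := hF (LinearMap.mulRight k (C.η r)) (fun b y => by
      simp [mul_assoc, ComoduleAlgebra.commute_of_mem_coinvariants (hf b)]) 1
    simp only [LinearMap.mulRight_apply, one_mul] at this
    rw [← this, hF1]
  have hco : F 1 ∈ C.coinvariants := d.coord_ext C fun j => by
    have := hF (d.coord C j ∘ₗ C.coact) (fun b y => by
      simp only [LinearMap.comp_apply, ComoduleAlgebra.coact_mul_coinvariant (hf b), coord_rmul]) 1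
    rw [LinearMap.comp_apply, C.coact_one, coord_tmul, one_mul, hF1, ← hη] at this
    rw [coord_tmul, this]
    rfl
  rw [← hG.range_eq] at hco
  obtain ⟨b, hb⟩ := hco
  exact ⟨b, fun a => by rw [hb, hF1]⟩

end RightBialgebroid.DualBasis

theorem RightBialgebroid.LeftProjective.depthTwo_and_balanced {k R T A B : Type*} [CommRing k]
    [Ring R] [Algebra k R] [Ring T] [Algebra k T] [Ring A] [Algebra k A] [Ring B] [Algebra k B]
    {D : RightBialgebroid k R T} {f : B →ₐ[k] A} (hD : D.LeftProjective)
    (h : D.IsGaloisExtension f) : AlgExt.IsRightDepthTwo f ∧ AlgExt.IsRightBalanced f := by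
  obtain ⟨⟨d⟩, C, hC⟩ := And.intro hD.exists_dualBasis h
  exact ⟨d.isRightDepthTwo hC, d.isRightBalanced hC⟩

end

theorem mainTheorem1 {k : Type w} {A : Type u} {B : Type v} [CommRing k] [Ring A] [Algebra k A]
    [Ring B] [Algebra k B] (f : B →ₐ[k] A) :
    -- the equivalence
    ((AlgExt.IsRightDepthTwo f ∧ AlgExt.IsRightBalanced f) ↔
      ∃ (R : Type u) (_ : Ring R) (_ : Algebra k R) (T : Type u) (_ : Ring T) (_ : Algebra k T)
        (D : RightBialgebroid k R T), D.LeftProjective ∧ D.IsGaloisExtension f) ∧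
    -- the backward direction for bialgebroids in arbitrary universes
    (∀ (R : Type x) (T : Type y) [Ring R] [Algebra k R] [Ring T] [Algebra k T]
      (D : RightBialgebroid k R T), D.LeftProjective → D.IsGaloisExtension f →
        AlgExt.IsRightDepthTwo f ∧ AlgExt.IsRightBalanced f) ∧
    -- the forward direction with the explicit bialgebroid `(A ⊗_B A)^B` over `C_A(B)`
    (AlgExt.IsRightDepthTwo f → AlgExt.IsRightBalanced f →
      (∃ (I : Type u) (γ : I → AlgExt.bimodEnd f) (e : I → AlgExt.TAlg f),
        AlgExt.IsRightQuasibase f γ e) ∧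
      ∃ (D : RightBialgebroid k (AlgExt.Cent f) (AlgExt.TAlg f)) (C : D.ComoduleAlgebra A),
        (∀ r, (D.s r).val = AlgExt.tmul f 1 (r : A)) ∧
        (∀ r, (D.t r).unop.val = AlgExt.tmul f (r : A) 1) ∧
        (∀ t, (D.counit t : A) = AlgExt.mu f t.val) ∧
        (∀ r, C.η r = (r : A)) ∧
        (∀ (I : Type z) (γ : I → AlgExt.bimodEnd f) (e : I → AlgExt.TAlg f),
          AlgExt.IsRightQuasibase f γ e →
            (∀ t, D.comul t =
              ∑ᶠ i, BalTensor.tmul (homAct D.s) (antiAct D.t)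
                (AlgExt.TAlg.applyRight (γ i) t) (e i)) ∧
            ∀ a, C.coact a =
              ∑ᶠ i, BalTensor.tmul (homAct C.η) (antiAct D.t) ((γ i).1 a) (e i)) ∧
        D.LeftProjective ∧ C.IsGalois f) := by
  refine ⟨⟨fun ⟨h, hb⟩ => ?_, fun ⟨R, _, _, T, _, _, D, hD, hG⟩ => hD.depthTwo_and_balanced hG⟩,
    fun R T _ _ _ _ D hD hG => hD.depthTwo_and_balanced hG, fun h hb => ?_⟩
  · obtain ⟨I, γ, e, hq⟩ := h.exists_quasibase
    exact ⟨_, _, _, _, _, _, hq.bialgebroid, hq.leftProjective, hq.comoduleAlgebra, hq.isGalois hb⟩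
  · obtain ⟨I, γ, e, hq⟩ := h.exists_quasibase
    exact ⟨⟨I, γ, e, hq⟩, hq.bialgebroid, hq.comoduleAlgebra, AlgExt.source_val,
      AlgExt.target_val, fun t => AlgExt.coeff_one t.val, fun _ => rfl,
      fun I' γ' e' hq' => ⟨hq.adapted_actionT.coaction_eq_finsum hq hq'.adapted_actionT,
        hq.adapted_actionA.coaction_eq_finsum hq hq'.adapted_actionA⟩,
      hq.leftProjective, hq.isGalois hb⟩
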